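/- **Setting.** Let $D\subset\mathbb R^d$ be a bounded domain (nonempty, open, connected), $X=L^2(D;\mathbb R)$, and let $\varphi=\{\varphi_n\}_{n\ge 1}$ be an orthonormal basis of $X$ one of whose elements is a constant function. For $N\ge1$ put $E_Nu=(\langle u,\varphi_1\rangle,\dots,\langle u,\varphi_N\rangle)\in\mathbb R^N$ and $D_N\alpha=\sum_{n\le N}\alpha_n\varphi_n$. Let $\sigma$ be either the rectified cubic unit (ReCU) $\sigma(x)=\max\{0,x\}^3$ or the rectified linear unit (ReLU) $\sigma(x)=\max\{0,x\}$. A neural network is a map $a_m\circ\sigma\circ a_{m-1}\circ\dots\circ\sigma\circ a_0$ between Euclidean spaces, with affine $a_j$, arbitrary finite depth and widths, and $\sigma$ acting componentwise. *Neural operators.* $\mathcal{NO}_{L,N,\varphi,\sigma}$ is the class of maps $X\to X$, $u_0\mapsto u_{L+1}$, given by $$u_{\ell+1}=\sigma\bigl(W^{(\ell)}u_\ell+K_N^{(\ell)}u_\ell+b^{(\ell)}\bigr)\ (0\le\ell\le L-1),\qquad u_{L+1}=W^{(L)}u_L+K^{(L)}_Nu_L+b^{(L)},$$ $$(K_N^{(\ell)}v)(x)=\sum_{p,q\le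 N}K^{(\ell)}_{p,q}\langle v,\varphi_p\rangle\varphi_q(x),$$ where $W^{(\ell)},K_{p,q}^{(\ell)}\in\mathbb R^{d_{\ell+1}\times d_\ell}$, $b^{(\ell)}\in\mathbb R^{d_{\ell+1}}$, $d_0=d_{L+1}=1$, and all $u_\ell$ are required to lie in $X^{d_\ell}$. $\mathcal{RNO}_{T,N,\varphi,\sigma}$ is the class of maps $(Id+G_T)\circ\dots\circ(Id+G_1)$ with $G_t\in\mathcal{NO}_{L_t,N,\varphi,\sigma}$ and some $L_t\ge1$. *Layers.* A layer of a neural operator is a map $F(x)=x+T_2G(T_1x)$ on $X$ with compact linear operators $T_1,T_2:X\to X$ and $G\in C^1(X;X)$; it is a layer of a bilipschitz neural operator if moreover $c\|x-y\|\le\|F(x)-F(y)\|\le C\|x-y\|$ for all $x,y\in X$, with some $c>0$, $C<\infty$. A generalized neural operator is a composition $A_m\circ S\circ F_m\circ\dots\circ A_1\circ S\circ F_1$ with $m\ge1$, layers $F_j$, bounded linear operators $A_j$ and a continuous map $S:X\to X$. **Statement.** Let $R>0$, let $F:X\to X$ be a layer of a bilipschitz neural operator, and let $\delta,\varepsilon\in(0,1)$.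 Then there are $T,N\ge1$, neural networks $NN_1,\dots,NN_T:\mathbb R^N\to\mathbb R^N$ with activation $\sigma$, a linear invertible map $A:X\to X$ that is either the identity or a reflection $x\mapsto x-2\langle x,e\rangle e$ with a unit vector $e\in X$, and $R'>0$, such that, with $B_t:=D_N\circ NN_t\circ E_N$ and $$G:=(Id+B_T)\circ\dots\circ(Id+B_1),\quad \Gamma_t:=B_X(0,R'+t\delta),$$ $$\tilde K_0:=A(B_X(0,R)),\quad \tilde K_t:=(Id+B_t)(\tilde K_{t-1}),$$ (balls are open) the following hold. 1. For each $t=1,\dots,T$ there is $L_t\ge1$ with $B_t\in\mathcal{NO}_{L_t,N,\varphi,\sigma}$; hence $G\in\mathcal{RNO}_{T,N,\varphi,\sigma}(L^2(D;\mathbb R))$. 2. $\sup_{x\in\overline B_X(0,R)}\|F(x)-G\circ A(x)\|_X\le\varepsilon$. 3. For each $t=1,\dots,T$ the block $Id+B_t$ is strongly monotone on $\Gamma_t$, i.e. $\langle (Id+B_t)x-(Id+B_t)y,x-y\rangle\ge\alpha\|x-y\|^2$ for $x,y\in\Gamma_t$ with some $\alpha>0$. If $\sigma$ is ReCU, it is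 also a $C^1$-diffeomorphism of $\Gamma_t$ onto its (open) image. 4. $\tilde K_t\subset\Gamma_t$ for $t=0,\dots,T$. For $t=1,\dots,T$, $\phi_t(x,y):=(y-B_t(x),\,y)$ maps $\Gamma_{t+1}\times\Gamma_t$ into itself, and with $\pi_1(x,y)=x$ and $e_1(y)=(0,y)$ the limit $$\mathcal L_t(y):=\lim_{n\to\infty}\pi_1\circ\phi_t^{\,n}\circ e_1(y),\qquad y\in\Gamma_t,$$ where $\phi_t^{\,n}$ is the $n$-fold composition, exists in $\Gamma_{t+1}$; moreover $\mathcal L_t(\tilde K_t)\subset\tilde K_{t-1}$. 5. $G\circ A:B_X(0,R)\to G\circ A(B_X(0,R))=\tilde K_T$ is bijective, and $$\bigl(G\circ A|_{B_X(0,R)}\bigr)^{-1}=A^{-1}\circ\Phi,\qquad \Phi:=\mathcal L_1\circ\mathcal L_2\circ\dots\circ\mathcal L_T:\tilde K_T\to A(B_X(0,R)),$$ and $\Phi$ is the restriction to $\tilde K_T$ of a generalized neural operator $X\to X$. -/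

import Mathlib

open MeasureTheory Filter Topology
open scoped Matrix InnerProductSpace

noncomputable section

/-! ### Activation functions and feedforward networks -/

/-- The rectified linear unit `x ↦ max {0, x}`. -/
def reluAct (x : ℝ) : ℝ := max 0 x

/-- The rectified cubic unit `x ↦ max {0, x}³`. -/
def recuAct (x : ℝ) : ℝ := max 0 x ^ 3

/-- `IsFeedforwardNet σ f`: the map `f : ℝⁿ → ℝᵐ` is a feedforward neural network (of arbitrary
finite depth and arbitrary widths) with activation function `σ` applied componentwise, that is
`f = a_L ∘ σ ∘ a_{L-1} ∘ ⋯ ∘ σ ∘ a_0` with affine maps `a_ℓ`. -/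
inductive IsFeedforwardNet (σ : ℝ → ℝ) :
    ∀ {n m : ℕ}, ((Fin n → ℝ) → (Fin m → ℝ)) → Prop
  | affine {n m : ℕ} (W : Matrix (Fin m) (Fin n) ℝ) (b : Fin m → ℝ) :
      IsFeedforwardNet σ (fun x => W *ᵥ x + b)
  | layer {n k m : ℕ} (W : Matrix (Fin k) (Fin n) ℝ) (b : Fin k → ℝ)
      (f : (Fin k → ℝ) → (Fin m → ℝ)) (hf : IsFeedforwardNet σ f) :
      IsFeedforwardNet σ (fun x => f (fun i => σ ((W *ᵥ x + b) i)))

/-! ### Notions on a real Hilbert space -/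

section Hilbert

variable {X : Type*} [NormedAddCommGroup X] [InnerProductSpace ℝ X]

/-- A layer of a (generalized) neural operator: `F(x) = x + T₂ G(T₁ x)` with compact linear
operators `T₁, T₂` and a nonlinear operator `G` of class `C¹`. -/
def IsNeuralOperatorLayer (F : X → X) : Prop :=
  ∃ (T₁ T₂ : X →L[ℝ] X) (G : X → X), IsCompactOperator T₁ ∧ IsCompactOperator T₂ ∧
    ContDiff ℝ 1 G ∧ ∀ x, F x = x + T₂ (G (T₁ x))

/-- `F` is bilipschitz. -/
def IsBilipschitz (F : X → X) : Prop :=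
  ∃ c C : ℝ, 0 < c ∧ ∀ x₁ x₂ : X,
    c * ‖x₁ - x₂‖ ≤ ‖F x₁ - F x₂‖ ∧ ‖F x₁ - F x₂‖ ≤ C * ‖x₁ - x₂‖

/-- A layer of a bilipschitz neural operator. -/
def IsBilipschitzLayer (F : X → X) : Prop :=
  IsNeuralOperatorLayer F ∧ IsBilipschitz F

/-- The composition `A_ℓ ∘ S ∘ F_ℓ ∘ ⋯ ∘ A_1 ∘ S ∘ F_1` (the identity for `ℓ = 0`). -/
def layerComp (S : X → X) (A : ℕ → X →L[ℝ] X) (F : ℕ → X → X) : ℕ → X → X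
  | 0 => id
  | ℓ + 1 => fun x => A (ℓ + 1) (S (F (ℓ + 1) (layerComp S A F ℓ x)))

/-- A generalized neural operator `A_L ∘ S ∘ F_L ∘ ⋯ ∘ A_1 ∘ S ∘ F_1`, where the `F_ℓ` are layers,
the `A_ℓ` are bounded linear operators and `S` is a continuous operation. -/
def IsGeneralizedNeuralOperator (H : X → X) : Prop :=
  ∃ (L : ℕ) (S : X → X) (A : ℕ → X →L[ℝ] X) (F : ℕ → X → X), 1 ≤ L ∧ Continuous S ∧
    (∀ ℓ, 1 ≤ ℓ → ℓ ≤ L → IsNeuralOperatorLayer (F ℓ)) ∧ H = layerComp S A F L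

/-- `F` is strongly monotone on the set `s`. -/
def StronglyMonotoneOn (F : X → X) (s : Set X) : Prop :=
  ∃ α : ℝ, 0 < α ∧ ∀ x₁ ∈ s, ∀ x₂ ∈ s, α * ‖x₁ - x₂‖ ^ 2 ≤ ⟪F x₁ - F x₂, x₁ - x₂⟫_ℝ

/-- `F` restricts to a `C¹`-diffeomorphism from the open set `s` onto the (open) image `F(s)`. -/
def IsC1DiffeoOn (F : X → X) (s : Set X) : Prop :=
  ∃ e : OpenPartialHomeomorph X X, e.source = s ∧ Set.EqOn e F s ∧
    ContDiffOn ℝ 1 e e.source ∧ ContDiffOn ℝ 1 e.symm e.target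

/-- The encoder `E_N u = (⟨u, φ_1⟩, …, ⟨u, φ_N⟩)` (the basis is indexed from `0` here). -/
def encoder (φ : HilbertBasis ℕ ℝ X) (N : ℕ) (u : X) : Fin N → ℝ :=
  fun n => ⟪u, φ n⟫_ℝ

/-- The decoder `D_N α = ∑_{n ≤ N} α_n φ_n`. -/
def decoder (φ : HilbertBasis ℕ ℝ X) (N : ℕ) (α : Fin N → ℝ) : X :=
  ∑ n, α n • φ n

/-- `(Id + B_t) ∘ ⋯ ∘ (Id + B_1)` (the identity for `t = 0`). -/
def residualComp (B : ℕ → X → X) : ℕ → X → X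
  | 0 => id
  | t + 1 => fun x => residualComp B t x + B (t + 1) (residualComp B t x)

/-- `L_1 ∘ L_2 ∘ ⋯ ∘ L_t` (the identity for `t = 0`). -/
def reverseComp (L : ℕ → X → X) : ℕ → X → X
  | 0 => id
  | t + 1 => reverseComp L t ∘ L (t + 1)

/-- One step `(x, y) ↦ (y - B(x), y)` of the fixed-point iteration that solves
`x + B(x) = y` for `x`. -/
def inversionStep (B : X → X) (z : X × X) : X × X := (z.2 - B z.1, z.2)

end Hilbert

/-! ### Neural operators on `L²(D; ℝ)` -/

section L2

variable {d : ℕ} {D : Set (EuclideanSpace ℝ (Fin d))}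

/-- The space `L²(D; ℝ)`, with respect to Lebesgue measure on `D ⊆ ℝᵈ`. -/
abbrev L2Space (D : Set (EuclideanSpace ℝ (Fin d))) : Type :=
  Lp ℝ 2 ((volume : Measure (EuclideanSpace ℝ (Fin d))).restrict D)

/-- The parameters of a neural operator of depth `L` and rank `N`: the widths `d_0, …, d_{L+1}`
with `d_0 = d_{L+1} = 1`, the weights `W^{(ℓ)}`, the biases `b^{(ℓ)}` and the kernel coefficients
`K_{p,q}^{(ℓ)}`. Only the indices `ℓ ≤ L` are used. -/
structure NeuralOperatorParams (L N : ℕ) where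
  width : ℕ → ℕ
  width_zero : width 0 = 1
  width_last : width (L + 1) = 1
  W : ∀ ℓ, Matrix (Fin (width (ℓ + 1))) (Fin (width ℓ)) ℝ
  b : ∀ ℓ, Fin (width (ℓ + 1)) → ℝ
  K : ∀ ℓ, Fin N → Fin N → Matrix (Fin (width (ℓ + 1))) (Fin (width ℓ)) ℝ

/-- The `i`-th component at `x ∈ D` of `W^{(ℓ)} v(x) + (K_N^{(ℓ)} v)(x) + b^{(ℓ)}`, where
`(K_N^{(ℓ)} v)(x) = ∑_{p,q ≤ N} K_{p,q}^{(ℓ)} ⟨v, φ_p⟩ φ_q(x)`. -/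
def NeuralOperatorParams.preActivation {L N : ℕ} (P : NeuralOperatorParams L N)
    (φ : HilbertBasis ℕ ℝ (L2Space D)) (ℓ : ℕ) (v : Fin (P.width ℓ) → L2Space D)
    (i : Fin (P.width (ℓ + 1))) (x : EuclideanSpace ℝ (Fin d)) : ℝ :=
  (P.W ℓ *ᵥ fun j => v j x) i
    + (∑ p, ∑ q, (P.K ℓ p q *ᵥ fun j => ⟪v j, φ p⟫_ℝ) i * φ q x)
    + P.b ℓ i

/-- The class of neural operators `G : L²(D) → L²(D)` with depth `L`, rank `N`, basis `φ` and
activation function `σ`: `G` sends `u_0` to `u_{L+1}`, where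
`u_{ℓ+1} = σ(W^{(ℓ)} u_ℓ + K_N^{(ℓ)} u_ℓ + b^{(ℓ)})` for `ℓ < L` and
`u_{L+1} = W^{(L)} u_L + K_N^{(L)} u_L + b^{(L)}`. Every `u_ℓ` has to be (componentwise) an element
of `L²(D)`; this is a condition on the parameters if `σ` grows superlinearly. -/
def NeuralOperatorClass (L N : ℕ) (φ : HilbertBasis ℕ ℝ (L2Space D)) (σ : ℝ → ℝ) :
    Set (L2Space D → L2Space D) :=
  {G | ∃ P : NeuralOperatorParams L N, ∀ u : L2Space D,
    ∃ v : ∀ ℓ, Fin (P.width ℓ) → L2Space D,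
      (∀ i, v 0 i = u) ∧
      (∀ ℓ < L, ∀ i, v (ℓ + 1) i =ᵐ[volume.restrict D]
        fun x => σ (P.preActivation φ ℓ (v ℓ) i x)) ∧
      (∀ i, v (L + 1) i =ᵐ[volume.restrict D] fun x => P.preActivation φ L (v L) i x) ∧
      ∀ i, G u = v (L + 1) i}

/-- The class of residual neural operators `(Id + G_T) ∘ ⋯ ∘ (Id + G_1)`, where each `G_t` is a
neural operator of some depth `L_t ≥ 1`, rank `N`, basis `φ` and activation function `σ`. -/
def ResidualNeuralOperatorClass (T N : ℕ) (φ : HilbertBasis ℕ ℝ (L2Space D)) (σ : ℝ → ℝ) :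
    Set (L2Space D → L2Space D) :=
  {G | ∃ B : ℕ → L2Space D → L2Space D,
    (∀ t, 1 ≤ t → t ≤ T → ∃ L, 1 ≤ L ∧ B t ∈ NeuralOperatorClass L N φ σ) ∧
    G = residualComp B T}

end L2

end

/-!
The theorem is reduced to finitely many coordinates and then proved by cutting a path of maps into
small pieces, each of which is replaced by a network with a small Lipschitz constant.

*Reduction.* Write `F = Id + T₂ ∘ G ∘ T₁` and let `Π` be the projection to the first `N` basis
elements. As `T₁` and `T₂` are compact, `T₁ (1 - Π)` and `(1 - Π) T₂` are small in norm for large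
`N`, and `G` is Lipschitz on the relatively compact image of the ball under `T₁`. Hence `F` is
uniformly close on the ball to `(1 - Π) + f ∘ Π`, where `f` is a `C¹` map of Euclidean space that is
bounded below on the ball (`IsBilipschitzLayer.exists_finite_dimensional`).

*Path.* The maps `x ↦ (f (s x) - f 0) / s + s f 0` connect `f` with its derivative at the origin,
with a common lower bound. The derivative is an invertible matrix, that is, a product of
transvections, positive diagonal matrices and coordinate reflections; the first two kinds lie on
one-parameter groups, and so do products of two reflections, which are rotations. Therefore `f` is
connected with the identity or with a single reflection (`exists_reachable_of_contDiff`). No inverse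
of the maps on the path is needed: along a subdivision, `b = (Id + β) ∘ a` with `β` defined on the
image of `a` only, and the lower bound for `a` makes `β` Lipschitz with a small constant there
(`CloseStep`).

*Networks.* A Lipschitz function on a bounded set is the infimum of the cones `x ↦ β y + η ‖x -
y‖₁`. Taking a finite net of points `y`, and truncating, one obtains a function on the whole space
that is uniformly close to `β`, bounded, and has the Lipschitz constant `η`; all this survives if
absolute value and minimum are expressed by the rectified linear unit or by a smoothing of it with
slopes in `[0, 1]`. Three rectified cubic units add up to such a smoothing
(`exists_isSoftRelu_recuAct`). This gives blocks `Id + B_t` with `B_t` bounded by `δ` and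
`1/4`-Lipschitz on the whole space (`exists_netFun_approx`,
`Reachable.exists_isSmallNet`). The global bound makes the radius `R' = R` sufficient.

*Conclusion.* As `B_t` is a contraction, `Id + B_t` is strongly monotone and a homeomorphism of the
space, whose inverse is the limit of the fixed-point iteration (`exists_isPerturbationInverse`), and
is `C¹` if `B_t` is. The constant basis element turns the coefficients of a function into constant
functions, on which a neural operator acts as a network; this realizes `B_t` as a neural operator
(`mem_neuralOperatorClass`).
-/

noncomputable section

/-! ### Calculus of feedforward networks -/

section Networks

/-- Scalar functions generated from the coordinates and the constants by linear combinations and by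
the activation function `σ`. -/
inductive NetFun (σ : ℝ → ℝ) {n : ℕ} : ((Fin n → ℝ) → ℝ) → Prop
  | coord (i : Fin n) : NetFun σ (fun x => x i)
  | const (c : ℝ) : NetFun σ (fun _ => c)
  | add {f g : (Fin n → ℝ) → ℝ} (hf : NetFun σ f) (hg : NetFun σ g) : NetFun σ (fun x => f x + g x)
  | smul (c : ℝ) {f : (Fin n → ℝ) → ℝ} (hf : NetFun σ f) : NetFun σ (fun x => c * f x)
  | act {f : (Fin n → ℝ) → ℝ} (hf : NetFun σ f) : NetFun σ (fun x => σ (f x))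

variable {σ : ℝ → ℝ}

namespace IsFeedforwardNet

theorem comp_affine {n k m : ℕ} {f : (Fin k → ℝ) → (Fin m → ℝ)} (hf : IsFeedforwardNet σ f)
    (W : Matrix (Fin k) (Fin n) ℝ) (b : Fin k → ℝ) :
    IsFeedforwardNet σ (fun x => f (W *ᵥ x + b)) := by
  cases hf with
  | affine W' b' =>
    convert IsFeedforwardNet.affine (σ := σ) (W' * W) (W' *ᵥ b + b') using 2 with x
    beta_reduce
    rw [Matrix.mulVec_add, Matrix.mulVec_mulVec, add_assoc]
  | layer W' b' g hg =>
    convert IsFeedforwardNet.layer (σ := σ) (W' * W) (W' *ᵥ b + b') g hg using 4 with x i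
    rw [Matrix.mulVec_add, Matrix.mulVec_mulVec, add_assoc]

theorem comp {n k m : ℕ} {g : (Fin k → ℝ) → (Fin m → ℝ)} {f : (Fin n → ℝ) → (Fin k → ℝ)}
    (hg : IsFeedforwardNet σ g) (hf : IsFeedforwardNet σ f) :
    IsFeedforwardNet σ (fun x => g (f x)) := by
  induction hf with
  | affine W b => exact hg.comp_affine W b
  | layer W b f _ ih => exact .layer W b _ (ih hg)

end IsFeedforwardNet

/-- The scalar function `g` is an affine function of the outputs of the map `F`. -/
def Covers {n m : ℕ} (F : (Fin n → ℝ) → (Fin m → ℝ)) (g : (Fin n → ℝ) → ℝ) : Prop :=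
  ∃ (w : Fin m → ℝ) (b : ℝ), ∀ x, g x = w ⬝ᵥ F x + b

namespace Covers

variable {n m : ℕ} {F : (Fin n → ℝ) → (Fin m → ℝ)} {f g : (Fin n → ℝ) → ℝ}

theorem const (c : ℝ) : Covers F (fun _ => c) := ⟨0, c, fun x => by simp⟩

theorem add (hf : Covers F f) (hg : Covers F g) : Covers F (fun x => f x + g x) := by
  obtain ⟨w, b, h⟩ := hf
  obtain ⟨w', b', h'⟩ := hg
  exact ⟨w + w', b + b', fun x => by beta_reduce; rw [h, h', add_dotProduct]; ring⟩

theorem smul (c : ℝ) (hf : Covers F f) : Covers F (fun x => c * f x) := by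
  obtain ⟨w, b, h⟩ := hf
  exact ⟨c • w, c * b, fun x => by beta_reduce; rw [h, smul_dotProduct, smul_eq_mul]; ring⟩

theorem sum {ι : Type*} (s : Finset ι) {f : ι → (Fin n → ℝ) → ℝ} (hf : ∀ i ∈ s, Covers F (f i)) :
    Covers F (fun x => ∑ i ∈ s, f i x) := by
  classical
  induction s using Finset.induction_on with
  | empty => simpa using const 0
  | insert a s ha ih =>
    simp only [Finset.sum_insert ha]
    exact (hf a (by simp)).add (ih fun i hi => hf i (by simp [hi]))

theorem of_outputs {k : ℕ} {F' : (Fin n → ℝ) → (Fin k → ℝ)} (hF : ∀ i, Covers F' (fun x => F x i))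
    (hf : Covers F f) : Covers F' f := by
  obtain ⟨w, b, h⟩ := hf
  have := (sum Finset.univ fun i _ => (hF i).smul (w i)).add (const b)
  convert this using 1
  funext x
  rw [h]; rfl

end Covers

/-- The identity is a linear combination of translates and dilates of `σ`, which allows a network to
carry values through its hidden layers. -/
def RepresentsId (σ : ℝ → ℝ) : Prop :=
  ∃ (J : ℕ) (a w c : Fin J → ℝ), ∀ t, t = ∑ j, a j * σ (w j * t + c j)

theorem exists_net_covers_hidden {n m : ℕ} {F : (Fin n → ℝ) → (Fin m → ℝ)}
    (hF : IsFeedforwardNet σ F) {κ : Type} [Fintype κ] (g : κ → (Fin n → ℝ) → ℝ)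
    (hg : ∀ i, Covers F (g i)) :
    ∃ (k : ℕ) (F' : (Fin n → ℝ) → (Fin k → ℝ)), IsFeedforwardNet σ F' ∧
      ∀ i, Covers F' (fun x => σ (g i x)) := by
  choose w b h using hg
  let e := Fintype.equivFin κ
  refine ⟨Fintype.card κ, fun x => (1 : Matrix _ _ ℝ) *ᵥ
    (fun i => σ ((Matrix.of (fun i => w (e.symm i)) *ᵥ F x + fun i => b (e.symm i)) i)) + 0,
    (IsFeedforwardNet.layer _ _ _ (.affine 1 0)).comp hF,
    fun i => ⟨Pi.single (e i) 1, 0, fun x => ?_⟩⟩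
  simp [h, Matrix.mulVec]

/-- A network can be enlarged so that it computes a further generated function and still computes
everything it did before. -/
theorem NetFun.exists_net_covers (hσ : RepresentsId σ) {n : ℕ} {f : (Fin n → ℝ) → ℝ}
    (hf : NetFun σ f) : ∀ {m : ℕ} (F : (Fin n → ℝ) → (Fin m → ℝ)), IsFeedforwardNet σ F →
      (∀ i, Covers F (fun x => x i)) →
      ∃ (k : ℕ) (F' : (Fin n → ℝ) → (Fin k → ℝ)), IsFeedforwardNet σ F' ∧
        (∀ i, Covers F' (fun x => F x i)) ∧ Covers F' f := by
  induction hf with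
  | coord i => exact fun F hF h => ⟨_, F, hF, fun j => ⟨Pi.single j 1, 0, by simp⟩, h i⟩
  | const c => exact fun F hF h => ⟨_, F, hF, fun j => ⟨Pi.single j 1, 0, by simp⟩, .const c⟩
  | smul c _ ih =>
    intro m F hF h
    obtain ⟨k, F', h1, h2, h3⟩ := ih F hF h
    exact ⟨k, F', h1, h2, h3.smul c⟩
  | add _ _ ih ih' =>
    intro m F hF h
    obtain ⟨k, F', h1, h2, h3⟩ := ih F hF h
    obtain ⟨k', F'', h1', h2', h3'⟩ := ih' F' h1 fun i => .of_outputs h2 (h i)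
    exact ⟨k', F'', h1', fun i => .of_outputs h2' (h2 i), (Covers.of_outputs h2' h3).add h3'⟩
  | @act f _ ih =>
    intro m F hF h
    obtain ⟨k, F', h1, h2, h3⟩ := ih F hF h
    obtain ⟨J, a, w, c, hid⟩ := hσ
    have hc : ∀ i, Covers F' (fun x => F' x i) := fun i => ⟨Pi.single i 1, 0, by simp⟩
    obtain ⟨k', F'', h1', h2'⟩ := exists_net_covers_hidden (σ := σ) h1 (κ := Unit ⊕ Fin k × Fin J)
      (fun i => i.elim (fun _ => f) fun p x => w p.2 * F' x p.1 + c p.2) (by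
        rintro (_ | ⟨i, j⟩)
        · exact h3
        · exact ((hc i).smul (w j)).add (.const (c j)))
    refine ⟨k', F'', h1', fun i => .of_outputs (F := F') (fun j => ?_) (h2 i), h2' (.inl ())⟩
    have := Covers.sum Finset.univ fun l _ => (h2' (.inr (j, l))).smul (a l)
    convert this using 1
    funext x
    exact hid (F' x j)

/-- Finitely many generated functions are the components of one network. -/
theorem isFeedforwardNet_of_netFun (hσ : RepresentsId σ) {n m : ℕ}
    (f : Fin m → (Fin n → ℝ) → ℝ) (hf : ∀ i, NetFun σ (f i)) :
    IsFeedforwardNet σ (fun x i => f i x) := by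
  have key : ∀ s : Finset (Fin m), ∃ (k : ℕ) (F : (Fin n → ℝ) → (Fin k → ℝ)),
      IsFeedforwardNet σ F ∧ (∀ i, Covers F (fun x => x i)) ∧ ∀ i ∈ s, Covers F (f i) := by
    intro s
    induction s using Finset.induction_on with
    | empty =>
      exact ⟨n, fun x => (1 : Matrix _ _ ℝ) *ᵥ x + 0, .affine 1 0,
        fun i => ⟨Pi.single i 1, 0, by simp⟩, by simp⟩
    | insert a s ha ih =>
      obtain ⟨k, F, h1, h2, h3⟩ := ih
      obtain ⟨k', F', h1', h2', h3'⟩ := (hf a).exists_net_covers hσ F h1 h2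
      refine ⟨k', F', h1', fun i => .of_outputs h2' (h2 i), fun i hi => ?_⟩
      rcases Finset.mem_insert.1 hi with rfl | hi
      · exact h3'
      · exact .of_outputs h2' (h3 i hi)
  obtain ⟨k, F, h1, -, h3⟩ := key Finset.univ
  choose w b h using fun i => h3 i (Finset.mem_univ i)
  convert (IsFeedforwardNet.affine (Matrix.of w) b).comp h1 using 1
  funext x i
  exact h i x

/-- A network can be written with at least one hidden layer. -/
theorem IsFeedforwardNet.exists_layer (hσ : RepresentsId σ) {n m : ℕ}
    {f : (Fin n → ℝ) → (Fin m → ℝ)} (hf : IsFeedforwardNet σ f) :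
    ∃ (k : ℕ) (W : Matrix (Fin k) (Fin n) ℝ) (b : Fin k → ℝ) (g : (Fin k → ℝ) → (Fin m → ℝ)),
      IsFeedforwardNet σ g ∧ f = fun x => g (fun i => σ ((W *ᵥ x + b) i)) := by
  cases hf with
  | layer W b g hg => exact ⟨_, W, b, g, hg, rfl⟩
  | affine W b =>
    obtain ⟨J, a, w, c, hid⟩ := hσ
    let e := Fintype.equivFin (Fin n × Fin J)
    refine ⟨_, Matrix.of fun i => Pi.single (e.symm i).1 (w (e.symm i).2),
      fun i => c (e.symm i).2, _, .affine (W * Matrix.of fun i j =>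
        if (e.symm j).1 = i then a (e.symm j).2 else 0) b, ?_⟩
    funext x
    rw [← Matrix.mulVec_mulVec]
    congr 2
    funext i
    simp only [Matrix.mulVec, dotProduct, Matrix.of_apply, Pi.add_apply]
    rw [← e.sum_comp, Fintype.sum_prod_type]
    simp only [Equiv.symm_apply_apply, ite_mul, zero_mul]
    rw [Finset.sum_eq_single i (by intro j _ hj; simp [hj]) (by simp)]
    simpa [Pi.single_apply] using hid (x i)

/-! ### Activation functions -/

theorem representsId_reluAct : RepresentsId reluAct := by
  refine ⟨2, ![1, -1], ![1, -1], ![0, 0], fun t => ?_⟩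
  simp only [Fin.sum_univ_two, reluAct]
  rcases le_total 0 t with h | h <;> simp [h]

theorem recuAct_sub_recuAct_neg (t : ℝ) : recuAct t - recuAct (-t) = t ^ 3 := by
  unfold recuAct
  rcases le_total 0 t with h | h
  · rw [max_eq_right h, max_eq_left (by linarith)]; ring
  · rw [max_eq_left h, max_eq_right (by linarith)]; ring

theorem representsId_recuAct : RepresentsId recuAct := by
  -- the second difference `(t + 1) ^ 3 + (t - 1) ^ 3 - 2 * t ^ 3 = 6 * t`
  refine ⟨6, ![1/6, -1/6, 1/6, -1/6, -1/3, 1/3], ![1, -1, 1, -1, 1, -1], ![1, -1, -1, 1, 0, 0],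
    fun t => ?_⟩
  have h1 := recuAct_sub_recuAct_neg (t + 1)
  have h2 := recuAct_sub_recuAct_neg (t - 1)
  have h3 := recuAct_sub_recuAct_neg t
  rw [show -(t + 1) = -t + -1 by ring] at h1
  rw [show -(t - 1) = -t + 1 by ring, sub_eq_add_neg] at h2
  simp only [Fin.sum_univ_six, Matrix.cons_val, one_mul, neg_one_mul, add_zero]
  linear_combination (-1/6) * h1 - (1/6) * h2 + (1/3) * h3

theorem hasDerivAt_recuAct (t : ℝ) : HasDerivAt recuAct (3 * max 0 t ^ 2) t := by
  rcases lt_trichotomy t 0 with h | rfl | h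
  · rw [max_eq_left h.le]
    have : recuAct =ᶠ[𝓝 t] fun _ => 0 := by
      filter_upwards [eventually_lt_nhds h] with s hs
      simp [recuAct, max_eq_left hs.le]
    simpa using (hasDerivAt_const t (0:ℝ)).congr_of_eventuallyEq this
  · rw [hasDerivAt_iff_isLittleO]
    simp only [recuAct, max_self]
    refine Asymptotics.IsBigO.trans_isLittleO (g := fun s : ℝ => s ^ 3) ?_ ?_
    · refine Asymptotics.IsBigO.of_bound 1 (Eventually.of_forall fun s => ?_)
      rcases le_total 0 s with h | h <;> simp [h]
    · simpa using Asymptotics.isLittleO_pow_pow (𝕜 := ℝ) (show 1 < 3 by norm_num)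
  · rw [max_eq_right h.le]
    have : recuAct =ᶠ[𝓝 t] fun s => s ^ 3 := by
      filter_upwards [eventually_gt_nhds h] with s hs
      simp [recuAct, max_eq_right hs.le]
    simpa using (hasDerivAt_pow 3 t).congr_of_eventuallyEq this

theorem contDiff_recuAct : ContDiff ℝ 1 recuAct := by
  rw [contDiff_one_iff_deriv]
  refine ⟨fun t => (hasDerivAt_recuAct t).differentiableAt, ?_⟩
  rw [funext fun t => (hasDerivAt_recuAct t).deriv]
  fun_prop

theorem NetFun.contDiff {n : ℕ} {f : (Fin n → ℝ) → ℝ} (hf : NetFun recuAct f) :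
    ContDiff ℝ 1 f := by
  induction hf with
  | coord i => fun_prop
  | const c => fun_prop
  | add _ _ ih ih' => exact ih.add ih'
  | smul c _ ih => exact contDiff_const.mul ih
  | act _ ih => exact contDiff_recuAct.comp ih

theorem NetFun.sum {n : ℕ} {ι : Type*} (s : Finset ι) {f : ι → (Fin n → ℝ) → ℝ}
    (hf : ∀ i ∈ s, NetFun σ (f i)) : NetFun σ (fun x => ∑ i ∈ s, f i x) := by
  classical
  induction s using Finset.induction_on with
  | empty => simpa using NetFun.const 0
  | insert a s ha ih =>
    simp only [Finset.sum_insert ha]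
    exact (hf a (by simp)).add (ih fun i hi => hf i (by simp [hi]))

/-- `ρ` is nondecreasing and `1`-Lipschitz, differs from the rectified linear unit by at most `κ`,
and preserves the class of generated functions. -/
structure IsSoftRelu (σ : ℝ → ℝ) (κ : ℝ) (ρ : ℝ → ℝ) : Prop where
  slope : ∀ s t, ∃ θ, 0 ≤ θ ∧ θ ≤ 1 ∧ ρ s - ρ t = θ * (s - t)
  dist_le : ∀ t, |ρ t - max 0 t| ≤ κ
  netFun : ∀ {n : ℕ} {f : (Fin n → ℝ) → ℝ}, NetFun σ f → NetFun σ (fun x => ρ (f x))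

theorem exists_slope_of_monotone {ρ : ℝ → ℝ} (h : ∀ s t, s ≤ t → 0 ≤ ρ t - ρ s ∧ ρ t - ρ s ≤ t - s)
    (s t : ℝ) : ∃ θ, 0 ≤ θ ∧ θ ≤ 1 ∧ ρ s - ρ t = θ * (s - t) := by
  rcases lt_trichotomy s t with hst | rfl | hst
  · have := h s t hst.le
    have h0 : 0 < t - s := by linarith
    refine ⟨(ρ t - ρ s) / (t - s), div_nonneg this.1 h0.le, ?_, ?_⟩
    · rw [div_le_one h0]; exact this.2
    · field_simp
      ring
  · exact ⟨0, le_rfl, zero_le_one, by simp⟩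
  · have := h t s hst.le
    have h0 : 0 < s - t := by linarith
    refine ⟨(ρ s - ρ t) / (s - t), div_nonneg this.1 h0.le, ?_, ?_⟩
    · rw [div_le_one h0]; exact this.2
    · field_simp

theorem isSoftRelu_reluAct {κ : ℝ} (hκ : 0 ≤ κ) : IsSoftRelu reluAct κ reluAct where
  slope := exists_slope_of_monotone fun s t h => by
    unfold reluAct
    constructor
    · linarith [max_le_max (le_refl (0 : ℝ)) h]
    · have : max 0 t ≤ max 0 s + (t - s) :=
        max_le (by linarith [le_max_left 0 s]) (by linarith [le_max_right 0 s])
      linarith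
  dist_le t := by simpa [reluAct] using hκ
  netFun := .act

theorem exists_isSoftRelu_recuAct {h : ℝ} (hh : 0 < h) : ∃ ρ, IsSoftRelu recuAct h ρ := by
  -- The second difference of `t ↦ t ^ 3` with step `h` is `6 * h ^ 2` times a translate of `t`; that
  -- of `recuAct` is a smooth transition from zero to this affine function.
  let ρ : ℝ → ℝ := fun t => (recuAct t - 2 * recuAct (t - h) + recuAct (t - 2 * h)) / (6 * h ^ 2)
  have hρ : ∀ t, HasDerivAt ρ
      ((max 0 t ^ 2 - 2 * max 0 (t - h) ^ 2 + max 0 (t - 2 * h) ^ 2) / (2 * h ^ 2)) t := by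
    intro t
    have h1 := hasDerivAt_recuAct t
    have h2 := (hasDerivAt_recuAct (t - h)).comp t ((hasDerivAt_id t).sub_const h)
    have h3 := (hasDerivAt_recuAct (t - 2 * h)).comp t ((hasDerivAt_id t).sub_const (2 * h))
    refine (((h1.sub (h2.const_mul 2)).add h3).div_const (6 * h ^ 2)).congr_deriv ?_
    rw [div_eq_div_iff (by positivity) (by positivity)]
    ring
  have hq : ∀ t, 0 ≤ (max 0 t ^ 2 - 2 * max 0 (t - h) ^ 2 + max 0 (t - 2 * h) ^ 2) / (2 * h ^ 2) ∧
      (max 0 t ^ 2 - 2 * max 0 (t - h) ^ 2 + max 0 (t - 2 * h) ^ 2) / (2 * h ^ 2) ≤ 1 := by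
    intro t
    rw [div_le_one (by positivity)]
    suffices H : 0 ≤ max 0 t ^ 2 - 2 * max 0 (t - h) ^ 2 + max 0 (t - 2 * h) ^ 2 ∧
      max 0 t ^ 2 - 2 * max 0 (t - h) ^ 2 + max 0 (t - 2 * h) ^ 2 ≤ 2 * h ^ 2 from
      ⟨div_nonneg H.1 (by positivity), H.2⟩
    rcases le_total t 0 with h0 | h0
    · rw [max_eq_left h0, max_eq_left (by linarith), max_eq_left (by linarith)]
      constructor <;> nlinarith
    rcases le_total t h with h1 | h1
    · rw [max_eq_right h0, max_eq_left (by linarith), max_eq_left (by linarith)]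
      constructor <;> nlinarith
    rcases le_total t (2 * h) with h2 | h2
    · rw [max_eq_right h0, max_eq_right (by linarith), max_eq_left (by linarith)]
      constructor <;> nlinarith
    · rw [max_eq_right h0, max_eq_right (by linarith), max_eq_right (by linarith)]
      constructor <;> nlinarith
  have hmono : Monotone ρ := monotone_of_hasDerivAt_nonneg hρ fun t => (hq t).1
  have hmono' : Monotone fun t => t - ρ t :=
    monotone_of_hasDerivAt_nonneg (fun t => (hasDerivAt_id t).sub (hρ t))
      fun t => sub_nonneg.2 (hq t).2
  have hneg : ∀ t ≤ 0, ρ t = 0 := fun t ht => by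
    simp only [ρ, recuAct]
    rw [max_eq_left ht, max_eq_left (by linarith), max_eq_left (by linarith)]
    simp
  have hpos : ∀ t, 2 * h ≤ t → ρ t = t - h := fun t ht => by
    simp only [ρ, recuAct]
    rw [max_eq_right (by linarith), max_eq_right (by linarith), max_eq_right (by linarith)]
    rw [div_eq_iff (by positivity)]
    ring
  refine ⟨ρ, exists_slope_of_monotone fun s t hst => ⟨sub_nonneg.2 (hmono hst), ?_⟩, fun t => ?_, ?_⟩
  · have := hmono' hst
    simp only at this
    linarith
  · rcases le_total t 0 with h0 | h0
    · rw [hneg t h0, max_eq_left h0]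
      simpa using hh.le
    · rw [max_eq_right h0, abs_le]
      have h1 := hmono' h0
      have h2 := hmono' (le_max_left t (2 * h))
      simp only [hneg 0 le_rfl, hpos _ (le_max_right t (2 * h))] at h1 h2
      constructor <;> linarith
  · intro n f hf
    have h2 := ((hf.add (.const (-h))).act.smul (-2)).add (hf.add (.const (-(2 * h)))).act
    convert (hf.act.add h2).smul (1 / (6 * h ^ 2)) using 2 with x
    simp only [ρ, sub_eq_add_neg]
    ring

/-- Networks with activation `σ` can carry values unchanged through hidden layers, and can compute
smoothings of the rectified linear unit that are as accurate as desired. -/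
structure IsAdmissibleActivation (σ : ℝ → ℝ) : Prop where
  representsId : RepresentsId σ
  exists_soft : ∀ κ > 0, ∃ ρ, IsSoftRelu σ κ ρ

theorem isAdmissibleActivation_of_eq (hσ : σ = recuAct ∨ σ = reluAct) :
    IsAdmissibleActivation σ := by
  rcases hσ with rfl | rfl
  · exact ⟨representsId_recuAct, fun κ hκ => exists_isSoftRelu_recuAct hκ⟩
  · exact ⟨representsId_reluAct, fun κ hκ => ⟨_, isSoftRelu_reluAct hκ.le⟩⟩

/-! ### Lipschitz-preserving approximation by networks -/

namespace IsSoftRelu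

variable {κ : ℝ} {ρ : ℝ → ℝ}

theorem softAbs_sub_abs (h : IsSoftRelu σ κ ρ) (t : ℝ) : |ρ t + ρ (-t) - (|t|)| ≤ 2 * κ := by
  have h1 := abs_le.1 (h.dist_le t)
  have h2 := abs_le.1 (h.dist_le (-t))
  have h3 : |t| = max 0 t + max 0 (-t) := by
    rcases le_total 0 t with h | h
    · rw [abs_of_nonneg h, max_eq_right h, max_eq_left (by linarith), add_zero]
    · rw [abs_of_nonpos h, max_eq_left h, max_eq_right (by linarith), zero_add]
  rw [h3, abs_le]
  constructor <;> linarith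

theorem softAbs_lipschitz (h : IsSoftRelu σ κ ρ) (s t : ℝ) :
    |(ρ s + ρ (-s)) - (ρ t + ρ (-t))| ≤ |s - t| := by
  obtain ⟨a, ha0, ha1, ha⟩ := h.slope s t
  obtain ⟨b, hb0, hb1, hb⟩ := h.slope (-s) (-t)
  have : (ρ s + ρ (-s)) - (ρ t + ρ (-t)) = (a - b) * (s - t) := by linear_combination ha + hb
  rw [this, abs_mul]
  exact mul_le_of_le_one_left (abs_nonneg _) (abs_le.2 ⟨by linarith, by linarith⟩)

theorem softMin_sub_min (h : IsSoftRelu σ κ ρ) (a b : ℝ) : |a - ρ (a - b) - min a b| ≤ κ := by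
  have h1 := h.dist_le (a - b)
  have h2 : min a b = a - max 0 (a - b) := by
    rcases le_total a b with h | h
    · rw [min_eq_left h, max_eq_left (by linarith), sub_zero]
    · rw [min_eq_right h, max_eq_right (by linarith), sub_sub_cancel]
  rw [h2, abs_sub_comm]
  convert h1 using 2
  ring

/-- The increments of the smoothed minimum are convex combinations of the increments of its
arguments. -/
theorem softMin_lipschitz (h : IsSoftRelu σ κ ρ) {a b a' b' c : ℝ} (ha : |a - a'| ≤ c)
    (hb : |b - b'| ≤ c) : |(a - ρ (a - b)) - (a' - ρ (a' - b'))| ≤ c := by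
  obtain ⟨θ, h0, h1, hθ⟩ := h.slope (a - b) (a' - b')
  have : (a - ρ (a - b)) - (a' - ρ (a' - b')) = (1 - θ) * (a - a') + θ * (b - b') := by
    linear_combination -hθ
  rw [this]
  rw [abs_le] at ha hb ⊢
  constructor <;> nlinarith

theorem netFun_softMin (h : IsSoftRelu σ κ ρ) {n : ℕ} {f g : (Fin n → ℝ) → ℝ} (hf : NetFun σ f)
    (hg : NetFun σ g) : NetFun σ (fun x => f x - ρ (f x - g x)) := by
  convert hf.add (.smul (-1) (h.netFun (hf.add (.smul (-1) hg)))) using 2 with x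
  rw [neg_one_mul, neg_one_mul, ← sub_eq_add_neg, ← sub_eq_add_neg]

end IsSoftRelu

/-- A smoothed version of the cone `x ↦ c + η * ‖x - y‖₁`. -/
theorem exists_netFun_cone (hσ : IsAdmissibleActivation σ) {n : ℕ} (y : Fin n → ℝ) (c : ℝ) {η : ℝ}
    (hη : 0 ≤ η) {κ : ℝ} (hκ : 0 < κ) :
    ∃ H : (Fin n → ℝ) → ℝ, NetFun σ H ∧ (∀ x x', |H x - H x'| ≤ η * ∑ k, |x k - x' k|) ∧
      ∀ x, |H x - (c + η * ∑ k, |x k - y k|)| ≤ κ := by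
  have hpos : 0 < 2 * n * η + 1 := by positivity
  obtain ⟨ρ, hρ⟩ := hσ.exists_soft (κ / (2 * n * η + 1)) (by positivity)
  refine ⟨fun x => c + η * ∑ k, (ρ (x k - y k) + ρ (-(x k - y k))), ?_, fun x x' => ?_, fun x => ?_⟩
  · refine .add (.const c) (.smul η (NetFun.sum _ fun k _ => .add ?_ ?_))
    · simpa only [sub_eq_add_neg] using hρ.netFun ((NetFun.coord k).add (.const (-y k)))
    · have := hρ.netFun (((NetFun.coord k).add (.const (-y k))).smul (-1))
      simpa only [sub_eq_add_neg, neg_one_mul] using this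
  · beta_reduce
    rw [add_sub_add_left_eq_sub, ← mul_sub, ← Finset.sum_sub_distrib, abs_mul, abs_of_nonneg hη]
    refine mul_le_mul_of_nonneg_left ((Finset.abs_sum_le_sum_abs _ _).trans
      (Finset.sum_le_sum fun k _ => ?_)) hη
    simpa using hρ.softAbs_lipschitz (x k - y k) (x' k - y k)
  · beta_reduce
    rw [add_sub_add_left_eq_sub, ← mul_sub, ← Finset.sum_sub_distrib, abs_mul, abs_of_nonneg hη]
    calc η * |∑ k, (ρ (x k - y k) + ρ (-(x k - y k)) - |x k - y k|)|
        ≤ η * ∑ k : Fin n, 2 * (κ / (2 * n * η + 1)) :=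
          mul_le_mul_of_nonneg_left ((Finset.abs_sum_le_sum_abs _ _).trans
            (Finset.sum_le_sum fun k _ => hρ.softAbs_sub_abs _)) hη
      _ = κ * ((2 * n * η) / (2 * n * η + 1)) := by
          rw [Finset.sum_const, Finset.card_univ, Fintype.card_fin, nsmul_eq_mul]
          ring
      _ ≤ κ := mul_le_of_le_one_right hκ.le ((div_le_one hpos).2 (by linarith))

/-- A smoothed version of the function `x ↦ min_{y ∈ t} (g y + η * ‖x - y‖₁)`. -/
theorem exists_netFun_min_cones (hσ : IsAdmissibleActivation σ) {n : ℕ} (g : (Fin n → ℝ) → ℝ)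
    {η : ℝ} (hη : 0 ≤ η) {t : Finset (Fin n → ℝ)} (ht : t.Nonempty) :
    ∀ κ > 0, ∃ H : (Fin n → ℝ) → ℝ, NetFun σ H ∧
      (∀ x x', |H x - H x'| ≤ η * ∑ k, |x k - x' k|) ∧
      (∀ x z, (∀ y ∈ t, z ≤ g y + η * ∑ k, |x k - y k|) → z - κ ≤ H x) ∧
      ∀ x, ∀ y ∈ t, H x ≤ g y + η * ∑ k, |x k - y k| + κ := by
  induction ht using Finset.Nonempty.cons_induction with
  | singleton y =>
    intro κ hκ
    obtain ⟨H, h1, h2, h3⟩ := exists_netFun_cone hσ y (g y) hη hκ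
    refine ⟨H, h1, h2, fun x z hz => ?_, fun x y' hy' => ?_⟩
    · have := hz y (by simp)
      have := abs_le.1 (h3 x)
      linarith
    · rw [Finset.mem_singleton.1 hy']
      have := abs_le.1 (h3 x)
      linarith
  | cons y t hy _ ih =>
    intro κ hκ
    obtain ⟨H, h1, h2, h3, h4⟩ := ih (κ / 2) (by linarith)
    obtain ⟨H', h1', h2', h3'⟩ := exists_netFun_cone hσ y (g y) hη (half_pos hκ)
    obtain ⟨ρ, hρ⟩ := hσ.exists_soft (κ / 2) (by linarith)
    refine ⟨_, hρ.netFun_softMin h1' h1, fun x x' => hρ.softMin_lipschitz (h2' x x') (h2 x x'),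
      fun x z hz => ?_, fun x y' hy' => ?_⟩
    · have ha := hz y (by simp)
      have hb := h3 x z fun y' hy' => hz y' (by simp [hy'])
      have hc := abs_le.1 (h3' x)
      have hd := abs_le.1 (hρ.softMin_sub_min (H' x) (H x))
      have : z - κ / 2 ≤ min (H' x) (H x) := le_min (by linarith) hb
      linarith
    · have hd := abs_le.1 (hρ.softMin_sub_min (H' x) (H x))
      rcases Finset.mem_cons.1 hy' with rfl | hy'
      · have hc := abs_le.1 (h3' x)
        have := min_le_left (H' x) (H x)
        linarith
      · have hc := h4 x y' hy'
        have := min_le_right (H' x) (H x)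
        linarith

/-- A bounded Lipschitz function on a totally bounded set is uniformly approximated by a scalar
network with the same Lipschitz constant and almost the same bound on the whole space. The network
is a smoothed version of McShane's formula `x ↦ min_y (g y + η * ‖x - y‖₁)`, with `y` ranging
over a finite net, truncated at the levels `±M`. -/
theorem exists_netFun_approx (hσ : IsAdmissibleActivation σ) {n : ℕ} {Y : Set (Fin n → ℝ)}
    (hY : TotallyBounded Y) {g : (Fin n → ℝ) → ℝ} {η : ℝ} (hη : 0 ≤ η)
    (hg : ∀ y ∈ Y, ∀ y' ∈ Y, g y - g y' ≤ η * ∑ k, |y k - y' k|) {M : ℝ} (hM0 : 0 ≤ M)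
    (hM : ∀ y ∈ Y, |g y| ≤ M) {κ : ℝ} (hκ : 0 < κ) :
    ∃ H : (Fin n → ℝ) → ℝ, NetFun σ H ∧ (∀ x x', |H x - H x'| ≤ η * ∑ k, |x k - x' k|) ∧
      (∀ x, |H x| ≤ M + κ) ∧ ∀ y ∈ Y, |H y - g y| ≤ κ := by
  rcases Y.eq_empty_or_nonempty with rfl | ⟨y₀, hy₀⟩
  · refine ⟨_, .const 0, fun x x' => ?_, fun x => ?_, by simp⟩
    · simpa using mul_nonneg hη (Finset.sum_nonneg fun k _ => abs_nonneg (x k - x' k))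
    · simpa using (by linarith : 0 ≤ M + κ)
  have hpos : 0 < 2 * n * η + 1 := by positivity
  obtain ⟨t, htY, htf, hcov⟩ := Metric.finite_approx_of_totallyBounded hY
    (κ / 4 / (2 * n * η + 1)) (by positivity)
  lift t to Finset (Fin n → ℝ) using htf
  have htn : t.Nonempty := by
    obtain ⟨y, hy, -⟩ := Set.mem_iUnion₂.1 (hcov hy₀)
    exact ⟨y, hy⟩
  obtain ⟨H, h1, h2, h3, h4⟩ := exists_netFun_min_cones hσ g hη htn (κ / 4) (by linarith)
  obtain ⟨ρ, hρ⟩ := hσ.exists_soft (κ / 4) (by linarith)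
  have hHg : ∀ y ∈ Y, |H y - g y| ≤ κ / 2 := by
    intro y hy
    obtain ⟨y', hy't, hyy'⟩ := Set.mem_iUnion₂.1 (hcov hy)
    have hlow := h3 y (g y) fun z hz => by linarith [hg y hy z (htY hz)]
    have hup := h4 y y' hy't
    have hgy := hg y' (htY hy't) y hy
    have hsum : η * ∑ k, |y k - y' k| ≤ κ / 8 := by
      calc η * ∑ k, |y k - y' k| ≤ η * ∑ k : Fin n, κ / 4 / (2 * n * η + 1) := by
            refine mul_le_mul_of_nonneg_left (Finset.sum_le_sum fun k _ => ?_) hη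
            rw [← Real.dist_eq]
            exact (dist_le_pi_dist y y' k).trans hyy'.le
        _ = κ / 8 * ((2 * n * η) / (2 * n * η + 1)) := by
            rw [Finset.sum_const, Finset.card_univ, Fintype.card_fin, nsmul_eq_mul]
            ring
        _ ≤ κ / 8 := mul_le_of_le_one_right (by linarith) ((div_le_one hpos).2 (by linarith))
    simp only [abs_sub_comm (y' _) (y _)] at hgy
    rw [abs_le]
    constructor <;> linarith
  let H₁ := fun x => H x - ρ (H x - M)
  have hH₁ : ∀ x, |H₁ x - min (H x) M| ≤ κ / 4 := fun x => hρ.softMin_sub_min (H x) M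
  have hH₁f : NetFun σ H₁ := hρ.netFun_softMin h1 (.const M)
  let H₂ := fun x => (-1) * H₁ x - ρ ((-1) * H₁ x - M)
  have hH₂ : ∀ x, |H₂ x - min (-H₁ x) M| ≤ κ / 4 := fun x => by
    simpa [H₂] using hρ.softMin_sub_min (-H₁ x) M
  have hnonneg : ∀ x x' : Fin n → ℝ, 0 ≤ η * ∑ k, |x k - x' k| := fun x x' =>
    mul_nonneg hη (Finset.sum_nonneg fun k _ => abs_nonneg _)
  have hH₁l : ∀ x x', |H₁ x - H₁ x'| ≤ η * ∑ k, |x k - x' k| := fun x x' =>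
    hρ.softMin_lipschitz (h2 x x') (by simpa using hnonneg x x')
  refine ⟨fun x => (-1) * H₂ x, .smul _ (hρ.netFun_softMin (.smul _ hH₁f) (.const M)),
    fun x x' => ?_, fun x => ?_, fun y hy => ?_⟩
  · rw [← mul_sub, abs_mul, abs_neg, abs_one, one_mul]
    refine hρ.softMin_lipschitz ?_ (by simpa using hnonneg x x')
    rw [← mul_sub, abs_mul, abs_neg, abs_one, one_mul]
    exact hH₁l x x'
  · have ha := abs_le.1 (hH₁ x)
    have hb := abs_le.1 (hH₂ x)
    beta_reduce
    rw [neg_one_mul, abs_neg, abs_le]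
    have h5 := min_le_right (H x) M
    have h6 := min_le_right (-H₁ x) M
    have h7 : -M - κ / 4 ≤ min (-H₁ x) M := le_min (by linarith) (by linarith)
    constructor <;> linarith
  · have ha := abs_le.1 (hH₁ y)
    have hb := abs_le.1 (hH₂ y)
    have hc := abs_le.1 (hHg y hy)
    have hd := abs_le.1 (hM y hy)
    beta_reduce
    rw [neg_one_mul, abs_le]
    -- truncation at a level that bounds `g` does not increase the distance to `g`
    have h5 : g y - κ / 2 ≤ min (H y) M := le_min (by linarith) (by linarith)
    have h6 := min_le_left (H y) M
    have h7 : -g y - 3 * (κ / 4) ≤ min (-H₁ y) M := le_min (by linarith) (by linarith)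
    have h8 := min_le_left (-H₁ y) M
    constructor <;> linarith

end Networks

/-! ### Chains of small steps between maps -/

section Chains

variable {α E : Type*} [NormedAddCommGroup E]

/-- On `S`, the map `b` is `(Id + β) ∘ a`, where `β` is bounded by `η` and `η`-Lipschitz on the image
`a(S)`. -/
def CloseStep (S : Set α) (η : ℝ) (a b : α → E) : Prop :=
  (∀ x ∈ S, ‖b x - a x‖ ≤ η) ∧
    ∀ x ∈ S, ∀ y ∈ S, ‖(b x - a x) - (b y - a y)‖ ≤ η * ‖a x - a y‖

/-- For arbitrarily small `η`, the map `a` is connected with `b` by finitely many steps. -/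
def Reachable (S : Set α) (a b : α → E) : Prop :=
  ∀ η > 0, Relation.ReflTransGen (CloseStep S η) a b

variable {S : Set α} {a b c : α → E}

theorem Reachable.refl (a : α → E) : Reachable S a a := fun _ _ => .refl

theorem Reachable.trans (h : Reachable S a b) (h' : Reachable S b c) : Reachable S a c :=
  fun η hη => (h η hη).trans (h' η hη)

/-- A path of maps whose increments are small relative to the map itself gives a chain, by
subdivision. -/
theorem reachable_of_path (H : ℝ → α → E)
    (h : ∀ η > 0, ∃ δ > 0, ∀ s ∈ Set.Icc (0 : ℝ) 1, ∀ s' ∈ Set.Icc (0 : ℝ) 1, |s' - s| < δ →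
      CloseStep S η (H s) (H s')) : Reachable S (H 0) (H 1) := by
  intro η hη
  obtain ⟨δ, hδ, hs⟩ := h η hη
  obtain ⟨n, hn⟩ := exists_nat_one_div_lt hδ
  have hn0 : (0 : ℝ) < n + 1 := by positivity
  have key : ∀ k : ℕ, k ≤ n + 1 →
      Relation.ReflTransGen (CloseStep S η) (H 0) (H (k / (n + 1))) := by
    intro k
    induction k with
    | zero => intro _; simpa using Relation.ReflTransGen.refl
    | succ k ih =>
      intro hk
      have hk' : (k : ℝ) + 1 ≤ n + 1 := by exact_mod_cast hk
      refine (ih (by omega)).tail (hs _ ⟨by positivity, ?_⟩ _ ⟨by positivity, ?_⟩ ?_)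
      · rw [div_le_one hn0]; linarith
      · rw [div_le_one hn0]; push_cast; linarith
      · push_cast
        rw [← sub_div, add_sub_cancel_left, abs_of_pos (by positivity)]
        exact hn
  have := key (n + 1) le_rfl
  rwa [Nat.cast_add_one, div_self hn0.ne'] at this

variable [NormedSpace ℝ E]

theorem Reachable.isometry_comp (A : E →ₗᵢ[ℝ] E) (h : Reachable S a b) :
    Reachable S (A ∘ a) (A ∘ b) := by
  intro η hη
  refine (h η hη).lift (fun a : α → E => A ∘ a) fun a b hab => ⟨fun x hx => ?_, fun x hx y hy => ?_⟩
  · simpa [← map_sub] using hab.1 x hx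
  · simpa [← map_sub] using hab.2 x hx y hy

/-- A bounded map is connected with its composition with an element of a one-parameter group of
operators. -/
theorem reachable_oneParameter {γ : ℝ → E →L[ℝ] E} (hγ : Continuous γ) (hγ0 : γ 0 = 1)
    (hadd : ∀ s t, γ (s + t) = γ s * γ t) {D : ℝ} (hD : ∀ x ∈ S, ‖a x‖ ≤ D) :
    Reachable S a (γ 1 ∘ a) := by
  obtain ⟨C, hC⟩ := (isCompact_Icc (a := (0 : ℝ)) (b := 1)).exists_bound_of_continuousOn
    hγ.continuousOn
  have hC0 : 0 ≤ C := (norm_nonneg _).trans (hC 0 (by simp))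
  have hpath : Reachable S (fun x => γ 0 (a x)) (fun x => γ 1 (a x)) := by
    refine reachable_of_path (fun s x => γ s (a x)) fun η hη => ?_
    have hpos : 0 < C * |D| + 1 := by positivity
    have hcont := Metric.continuousAt_iff.1
      (hγ.continuousAt (x := 0)) (η / (C * |D| + 1)) (by positivity)
    obtain ⟨δ, hδ, hclose⟩ := hcont
    refine ⟨δ, hδ, fun s hs s' _ hss' => ?_⟩
    have hsmall : ‖γ (s' - s) - 1‖ ≤ η / (C * |D| + 1) := by
      rw [← hγ0, ← dist_eq_norm]
      exact (hclose (by simpa using hss')).le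
    have heq : ∀ v, γ s' v - γ s v = (γ (s' - s) - 1) (γ s v) := fun v => by
      conv_lhs => rw [← sub_add_cancel s' s, hadd]
      simp
    have hle : η / (C * |D| + 1) ≤ η :=
      div_le_self hη.le (by linarith [mul_nonneg hC0 (abs_nonneg D)])
    refine ⟨fun x hx => ?_, fun x _ y _ => ?_⟩
    · rw [heq]
      calc _ ≤ ‖γ (s' - s) - 1‖ * (‖γ s‖ * ‖a x‖) :=
            (ContinuousLinearMap.le_opNorm _ _).trans
              (mul_le_mul_of_nonneg_left (ContinuousLinearMap.le_opNorm _ _) (norm_nonneg _))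
        _ ≤ η / (C * |D| + 1) * (C * |D|) := by
            have := (hD x hx).trans (le_abs_self D)
            have := hC s hs
            gcongr
        _ = η * ((C * |D|) / (C * |D| + 1)) := by ring
        _ ≤ η := mul_le_of_le_one_right hη.le ((div_le_one hpos).2 (by linarith))
    · rw [heq, heq, ← map_sub]
      refine (ContinuousLinearMap.le_opNorm _ _).trans ?_
      exact mul_le_mul_of_nonneg_right (hsmall.trans hle) (norm_nonneg _)
  have h0 : (fun x => γ 0 (a x)) = a := by simp [hγ0]
  rwa [h0] at hpath

end Chains

/-! ### Invertible linear maps -/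

section OneParameter

variable {𝒜 : Type*} [Ring 𝒜] [Algebra ℝ 𝒜]

theorem unipotent_add {n : 𝒜} (h : n * n = 0) (s t : ℝ) :
    1 + (s + t) • n = (1 + s • n) * (1 + t • n) := by
  simp only [mul_add, add_mul, one_mul, mul_one, smul_mul_smul_comm, h, smul_zero]
  module

theorem unipotent_zero (n : 𝒜) : 1 + (0 : ℝ) • n = 1 := by simp

theorem rotation_zero (q j : 𝒜) : 1 + (Real.cos 0 - 1) • q + Real.sin 0 • j = 1 := by simp

theorem rotation_pi (q j : 𝒜) :
    1 + (Real.cos Real.pi - 1) • q + Real.sin Real.pi • j = 1 + (-2 : ℝ) • q := by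
  rw [Real.cos_pi, Real.sin_pi]
  module

theorem rotation_add {q j : 𝒜} (hqq : q * q = q) (hqj : q * j = j) (hjq : j * q = j)
    (hjj : j * j = -q) (s t : ℝ) :
    1 + (Real.cos (s + t) - 1) • q + Real.sin (s + t) • j =
      (1 + (Real.cos s - 1) • q + Real.sin s • j) *
        (1 + (Real.cos t - 1) • q + Real.sin t • j) := by
  simp only [mul_add, add_mul, one_mul, mul_one, smul_mul_smul_comm, hqq, hqj, hjq, hjj,
    Real.cos_add, Real.sin_add]
  module

end OneParameter

section Linear

variable {N : ℕ}

local notation "E" => EuclideanSpace ℝ (Fin N)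

/-- The matrix of the reflection in the `i`-th coordinate. -/
def coordReflection (i : Fin N) : Matrix (Fin N) (Fin N) ℝ :=
  Matrix.diagonal fun j => if j = i then -1 else 1

/-- The operator on Euclidean space with a given matrix. -/
abbrev euclOp (M : Matrix (Fin N) (Fin N) ℝ) : E →L[ℝ] E :=
  Matrix.toEuclideanCLM (n := Fin N) (𝕜 := ℝ) M

theorem coordReflection_mul_self (i : Fin N) : coordReflection i * coordReflection i = 1 := by
  rw [coordReflection, Matrix.diagonal_mul_diagonal, ← Matrix.diagonal_one]
  congr 1
  funext j
  split_ifs <;> simp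

theorem euclOp_diagonal_apply (d : Fin N → ℝ) (x : E) (j : Fin N) :
    euclOp (Matrix.diagonal d) x j = d j * x j := by
  rw [Matrix.ofLp_toEuclideanCLM, Matrix.mulVec_diagonal]

theorem norm_euclOp_coordReflection (i : Fin N) (x : E) :
    ‖euclOp (coordReflection i) x‖ = ‖x‖ := by
  rw [EuclideanSpace.norm_eq, EuclideanSpace.norm_eq]
  congr 1
  refine Finset.sum_congr rfl fun j _ => ?_
  rw [coordReflection, euclOp_diagonal_apply]
  split_ifs <;> simp

/-- Every bounded map `a` is connected with `M ∘ a` or, up to the reflection in the coordinate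
`i₀`, with it. -/
def IsReachableMatrix {α : Type*} (S : Set α) (i₀ : Fin N) (M : Matrix (Fin N) (Fin N) ℝ) : Prop :=
  ∀ a : α → E, (∃ D, ∀ x ∈ S, ‖a x‖ ≤ D) →
    Reachable S a (euclOp M ∘ a) ∨ Reachable S (euclOp (coordReflection i₀) ∘ a) (euclOp M ∘ a)

namespace IsReachableMatrix

variable {α : Type*} {S : Set α} {i₀ : Fin N}

theorem bounded_comp {a : α → E} (M : E →L[ℝ] E) (h : ∃ D, ∀ x ∈ S, ‖a x‖ ≤ D) :
    ∃ D, ∀ x ∈ S, ‖(M ∘ a) x‖ ≤ D := by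
  obtain ⟨D, hD⟩ := h
  exact ⟨‖M‖ * D, fun x hx => (M.le_opNorm _).trans
    (mul_le_mul_of_nonneg_left (hD x hx) (norm_nonneg _))⟩

theorem one : IsReachableMatrix S i₀ 1 := fun a _ => .inl (by
  have : euclOp (1 : Matrix (Fin N) (Fin N) ℝ) ∘ a = a := by
    funext x; simp [euclOp]
  rw [this]; exact .refl a)

/-- Reflections of chains are chains, so two reflections that occur along the way cancel. -/
theorem mul {M M' : Matrix (Fin N) (Fin N) ℝ} (hM : IsReachableMatrix S i₀ M)
    (hM' : IsReachableMatrix S i₀ M') : IsReachableMatrix S i₀ (M * M') := by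
  intro a ha
  have hcomp : euclOp (M * M') ∘ a = euclOp M ∘ (euclOp M' ∘ a) := by
    funext x; simp [euclOp]
  have hinv : ∀ b : α → E, euclOp (coordReflection i₀) ∘ (euclOp (coordReflection i₀) ∘ b) = b := by
    intro b
    funext x
    change (euclOp (coordReflection i₀) * euclOp (coordReflection i₀)) (b x) = b x
    rw [← map_mul, coordReflection_mul_self, map_one]; rfl
  let A : E →ₗᵢ[ℝ] E := ⟨(euclOp (coordReflection i₀)).toLinearMap, norm_euclOp_coordReflection i₀⟩
  have hA : ∀ {b c : α → E}, Reachable S b c →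
      Reachable S (euclOp (coordReflection i₀) ∘ b) (euclOp (coordReflection i₀) ∘ c) :=
    fun h => h.isometry_comp A
  rw [hcomp]
  rcases hM' a ha with h1 | h1 <;> rcases hM _ (bounded_comp (euclOp M') ha) with h2 | h2
  · exact .inl (h1.trans h2)
  · exact .inr ((hA h1).trans h2)
  · exact .inr (h1.trans h2)
  · have := hA h1
    rw [hinv] at this
    exact .inl (this.trans h2)

theorem of_oneParameter {γ : ℝ → E →L[ℝ] E} (hγ : Continuous γ) (hγ0 : γ 0 = 1)
    (hadd : ∀ s t, γ (s + t) = γ s * γ t) {M : Matrix (Fin N) (Fin N) ℝ} (hM : euclOp M = γ 1) :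
    IsReachableMatrix S i₀ M := by
  rintro a ⟨D, hD⟩
  rw [hM]
  exact .inl (reachable_oneParameter hγ hγ0 hadd hD)

theorem transvection (t : Matrix.TransvectionStruct (Fin N) ℝ) :
    IsReachableMatrix S i₀ t.toMatrix := by
  obtain ⟨i, j, hij, c⟩ := t
  refine of_oneParameter (γ := fun s => 1 + s • euclOp (Matrix.single i j c)) (by fun_prop)
    (unipotent_zero _) (unipotent_add ?_) ?_
  · rw [← map_mul, Matrix.single_mul_single_of_ne _ _ _ _ hij.symm, map_zero]
  · simp [Matrix.TransvectionStruct.toMatrix, Matrix.transvection, euclOp]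

/-- The product of two coordinate reflections is a rotation by the angle `π`. -/
theorem coordReflection_mul {i : Fin N} (hi : i ≠ i₀) :
    IsReachableMatrix S i₀ (coordReflection i * coordReflection i₀) := by
  set Q : Matrix (Fin N) (Fin N) ℝ := Matrix.single i i 1 + Matrix.single i₀ i₀ 1 with hQ
  set J : Matrix (Fin N) (Fin N) ℝ := Matrix.single i i₀ 1 - Matrix.single i₀ i 1 with hJ
  have hQQ : euclOp Q * euclOp Q = euclOp Q := by
    rw [← map_mul, hQ]
    simp [mul_add, add_mul, hi, hi.symm]
  have hQJ : euclOp Q * euclOp J = euclOp J := by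
    rw [← map_mul, hQ, hJ]
    simp [mul_sub, add_mul, hi, hi.symm]
  have hJQ : euclOp J * euclOp Q = euclOp J := by
    rw [← map_mul, hQ, hJ]
    simp [mul_add, sub_mul, hi, hi.symm]
    abel
  have hJJ : euclOp J * euclOp J = -euclOp Q := by
    rw [← map_mul, ← map_neg, hQ, hJ]
    simp [mul_sub, sub_mul, hi, hi.symm]
    abel
  refine of_oneParameter (γ := fun s => 1 + (Real.cos (Real.pi * s) - 1) • euclOp Q +
    Real.sin (Real.pi * s) • euclOp J) (by fun_prop) ?_ (fun s t => ?_) ?_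
  · rw [mul_zero]
    exact rotation_zero _ _
  · rw [mul_add]
    exact rotation_add hQQ hQJ hJQ hJJ _ _
  · have : coordReflection i * coordReflection i₀ = 1 + (-2 : ℝ) • Q := by
      rw [coordReflection, coordReflection, Matrix.diagonal_mul_diagonal]
      ext k l
      rw [hQ]
      simp only [Matrix.diagonal_apply, Matrix.add_apply, Matrix.one_apply, Matrix.smul_apply,
        Matrix.single_apply, smul_eq_mul]
      grind
    rw [this, mul_one]
    refine Eq.trans ?_ (rotation_pi (euclOp Q) (euclOp J)).symm
    simp only [euclOp, map_add, map_one, map_smul]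

theorem reflection (i : Fin N) : IsReachableMatrix S i₀ (coordReflection i) := by
  have h₀ : IsReachableMatrix S i₀ (coordReflection i₀) := fun a _ => .inr (.refl _)
  by_cases hi : i = i₀
  · rwa [hi]
  · have := (coordReflection_mul (S := S) hi).mul h₀
    rwa [mul_assoc, coordReflection_mul_self, mul_one] at this

/-- The absolute values of the entries form a one-parameter group, and the signs a product of
reflections. -/
theorem diagonal {d : Fin N → ℝ} (hd : ∀ i, d i ≠ 0) :
    IsReachableMatrix S i₀ (Matrix.diagonal d) := by
  have hpos : IsReachableMatrix S i₀ (Matrix.diagonal fun i => |d i|) := by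
    let ℓ : (Fin N → ℝ) →ₗ[ℝ] (E →L[ℝ] E) :=
      (Matrix.toEuclideanCLM (n := Fin N) (𝕜 := ℝ)).toAlgEquiv.toLinearMap ∘ₗ
        Matrix.diagonalLinearMap (Fin N) ℝ ℝ
    have hℓ : ∀ v, ℓ v = euclOp (Matrix.diagonal v) := fun v => rfl
    refine of_oneParameter (γ := fun s => ℓ fun i => |d i| ^ s) ?_ ?_ (fun s t => ?_) ?_
    · refine (LinearMap.continuous_of_finiteDimensional ℓ).comp (continuous_pi fun i => ?_)
      exact Real.continuous_const_rpow (abs_ne_zero.2 (hd i))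
    · simp [hℓ, euclOp]
    · rw [hℓ, hℓ, hℓ, ← map_mul, Matrix.diagonal_mul_diagonal]
      congr 2
      funext i
      exact Real.rpow_add (abs_pos.2 (hd i)) s t
    · simp [hℓ]
  have hsign : ∀ s : Finset (Fin N),
      IsReachableMatrix S i₀ (Matrix.diagonal fun i => if i ∈ s then (-1 : ℝ) else 1) := by
    intro s
    induction s using Finset.induction_on with
    | empty => simpa using one
    | insert k s hk ih =>
      convert (reflection k).mul ih using 1
      rw [coordReflection, Matrix.diagonal_mul_diagonal]
      congr 1
      funext i
      by_cases hik : i = k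
      · simp [hik, hk]
      · simp [hik]
  convert hpos.mul (hsign (Finset.univ.filter fun i => d i < 0)) using 1
  rw [Matrix.diagonal_mul_diagonal]
  congr 1
  funext i
  rcases lt_or_ge (d i) 0 with h | h
  · simp [h, abs_of_neg h]
  · simp [h.not_gt, abs_of_nonneg h]

theorem of_det_ne_zero {M : Matrix (Fin N) (Fin N) ℝ} (hM : M.det ≠ 0) :
    IsReachableMatrix S i₀ M := by
  refine Matrix.diagonal_transvection_induction_of_det_ne_zero _ M hM (fun d hd => ?_)
    transvection fun _ _ _ _ h h' => h.mul h'
  rw [Matrix.det_diagonal, Finset.prod_ne_zero_iff] at hd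
  exact diagonal fun i => hd i (Finset.mem_univ i)

end IsReachableMatrix

/-! ### Differentiable bilipschitz maps of Euclidean space -/

/-- Every `C¹` map that is bounded below on a ball is connected with the identity or with a
reflection. The maps `x ↦ (f (s x) - f 0) / s + s f 0` all have the same lower bound as `f` and
connect `f`, for `s = 1`, with the invertible linear map `Df(0)`, for `s = 0`. -/
theorem exists_reachable_of_contDiff (i₀ : Fin N) {f : E → E} (hf : ContDiff ℝ 1 f) {R c : ℝ}
    (hR : 0 < R) (hc : 0 < c) (hlow : ∀ x ∈ Metric.closedBall (0 : E) R,
      ∀ y ∈ Metric.closedBall (0 : E) R, c * ‖x - y‖ ≤ ‖f x - f y‖) :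
    Reachable (Metric.closedBall (0 : E) R) id f ∨
      Reachable (Metric.closedBall (0 : E) R) (euclOp (coordReflection i₀)) f := by
  set S := Metric.closedBall (0 : E) R with hS
  have hfd : ∀ x, HasFDerivAt f (fderiv ℝ f x) x := fun x =>
    (hf.differentiable one_ne_zero x).hasFDerivAt
  have hsmul : ∀ s ∈ Set.Icc (0 : ℝ) 1, ∀ x ∈ S, s • x ∈ S := fun s hs x hx => by
    rw [hS, mem_closedBall_zero_iff] at hx ⊢
    rw [norm_smul, Real.norm_of_nonneg hs.1]
    exact (mul_le_of_le_one_left (norm_nonneg _) hs.2).trans hx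
  let H : ℝ → E → E := fun s x =>
    if s = 0 then fderiv ℝ f 0 x else s⁻¹ • (f (s • x) - f 0) + s • f 0
  have hHd : ∀ s x, HasFDerivAt (H s) (fderiv ℝ f (s • x)) x := by
    intro s x
    by_cases hs : s = 0
    · simp only [H, hs, if_true, zero_smul]
      exact (fderiv ℝ f 0).hasFDerivAt
    · simp only [H, hs, if_false]
      have h1 : HasFDerivAt (fun x : E => s • x) (s • ContinuousLinearMap.id ℝ E) x :=
        (hasFDerivAt_id x).const_smul s
      refine ((((hfd (s • x)).comp x h1).sub_const (f 0)).const_smul s⁻¹).add_const _ |>.congr_fderiv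
        ?_
      ext v
      simp [smul_smul, inv_mul_cancel₀ hs]
  have hlow0 : ∀ v ∈ S, c * ‖v‖ ≤ ‖fderiv ℝ f 0 v‖ := by
    intro v hv
    have h1 : HasDerivAt (fun t : ℝ => f (t • v)) (fderiv ℝ f 0 v) 0 := by
      have h2 : HasDerivAt (fun t : ℝ => t • v) v 0 := by
        simpa using (hasDerivAt_id (0 : ℝ)).smul_const v
      have h3 : HasFDerivAt f (fderiv ℝ f 0) ((0 : ℝ) • v) := by simpa using hfd 0
      exact h3.comp_hasDerivAt 0 h2
    have h4 := h1.tendsto_slope_zero_right.norm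
    refine ge_of_tendsto h4 ?_
    filter_upwards [Ioc_mem_nhdsGT (zero_lt_one' ℝ)] with t ht
    have h5 := hlow _ (hsmul t ⟨ht.1.le, ht.2⟩ v hv) 0 (by simp [hS, hR.le])
    rw [sub_zero, norm_smul, Real.norm_of_nonneg ht.1.le] at h5
    rw [zero_add, zero_smul, norm_smul, norm_inv, Real.norm_of_nonneg ht.1.le,
      ← div_eq_inv_mul, le_div_iff₀ ht.1]
    linarith
  have hlow0' : ∀ v, c * ‖v‖ ≤ ‖fderiv ℝ f 0 v‖ := by
    intro v
    rcases eq_or_ne v 0 with rfl | hv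
    · simp
    have hv' : 0 < ‖v‖ := norm_pos_iff.2 hv
    have h1 := hlow0 ((R / ‖v‖) • v) (by
      rw [hS, mem_closedBall_zero_iff, norm_smul, Real.norm_of_nonneg (by positivity),
        div_mul_cancel₀ _ hv'.ne'])
    rw [map_smul, norm_smul, norm_smul] at h1
    have h2 : 0 < ‖R / ‖v‖‖ := norm_pos_iff.2 (by positivity)
    exact le_of_mul_le_mul_left (by linarith) h2
  have hHlow : ∀ s ∈ Set.Icc (0 : ℝ) 1, ∀ x ∈ S, ∀ y ∈ S, c * ‖x - y‖ ≤ ‖H s x - H s y‖ := by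
    intro s hs x hx y hy
    by_cases hs0 : s = 0
    · simp only [H, hs0, if_true, ← map_sub]
      exact hlow0' _
    · have hs' : 0 < s := lt_of_le_of_ne hs.1 (Ne.symm hs0)
      have h1 := hlow _ (hsmul s hs x hx) _ (hsmul s hs y hy)
      have h2 : H s x - H s y = s⁻¹ • (f (s • x) - f (s • y)) := by
        simp only [H, hs0, if_false]
        module
      rw [← smul_sub, norm_smul, Real.norm_of_nonneg hs.1] at h1
      rw [h2, norm_smul, norm_inv, Real.norm_of_nonneg hs.1, ← div_eq_inv_mul, le_div_iff₀ hs']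
      linarith
  have hpath : Reachable S (H 0) (H 1) := by
    refine reachable_of_path H fun η hη => ?_
    -- the derivative of `H s` at `x` is `Df(s x)`, and `Df` is uniformly continuous on the ball
    have huc : UniformContinuousOn (fderiv ℝ f) S :=
      (isCompact_closedBall (0 : E) R).uniformContinuousOn_of_continuous
        (hf.continuous_fderiv one_ne_zero).continuousOn
    set η' := min (η * c) (η / (2 * R)) with hη'
    have hη'pos : 0 < η' := lt_min (by positivity) (by positivity)
    obtain ⟨δ, hδ, hclose⟩ := Metric.uniformContinuousOn_iff.1 huc η' hη'pos
    refine ⟨min (δ / R) (η / (2 * (‖f 0‖ + 1))), lt_min (by positivity) (by positivity),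
      fun s hs s' hs' hss' => ?_⟩
    have hlip : ∀ x ∈ S, ∀ y ∈ S, ‖(H s' x - H s x) - (H s' y - H s y)‖ ≤ η' * ‖x - y‖ := by
      intro x hx y hy
      refine (convex_closedBall (0 : E) R).norm_image_sub_le_of_norm_hasFDerivWithin_le
        (f := fun x => H s' x - H s x) (f' := fun x => fderiv ℝ f (s' • x) - fderiv ℝ f (s • x))
        (fun z _ => ((hHd s' z).sub (hHd s z)).hasFDerivWithinAt) (fun z hz => ?_) hy hx
      rw [← dist_eq_norm]
      refine (hclose _ (hsmul s' hs' z hz) _ (hsmul s hs z hz) ?_).le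
      rw [dist_eq_norm, ← sub_smul, norm_smul, Real.norm_eq_abs]
      calc |s' - s| * ‖z‖ ≤ |s' - s| * R :=
            mul_le_mul_of_nonneg_left (mem_closedBall_zero_iff.1 hz) (abs_nonneg _)
        _ < δ / R * R := mul_lt_mul_of_pos_right (hss'.trans_le (min_le_left _ _)) hR
        _ = δ := div_mul_cancel₀ _ hR.ne'
    have h0 : ∀ s, H s 0 = s • f 0 := fun s => by
      by_cases hs0 : s = 0 <;> simp [H, hs0]
    refine ⟨fun x hx => ?_, fun x hx y hy => ?_⟩
    · have h1 := hlip x hx 0 (by simp [hS, hR.le])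
      rw [h0, h0, ← sub_smul, sub_zero] at h1
      have h2 : ‖(s' - s) • f 0‖ ≤ η / 2 := by
        rw [norm_smul, Real.norm_eq_abs]
        calc |s' - s| * ‖f 0‖ ≤ η / (2 * (‖f 0‖ + 1)) * (‖f 0‖ + 1) := by
              have := hss'.le.trans (min_le_right _ _)
              gcongr
              linarith
          _ = η / 2 := by field_simp
      have h3 : η' * ‖x‖ ≤ η / 2 := by
        calc η' * ‖x‖ ≤ η / (2 * R) * R :=
              mul_le_mul (min_le_right _ _) (mem_closedBall_zero_iff.1 hx) (norm_nonneg _)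
                (by positivity)
          _ = η / 2 := by field_simp
      calc ‖H s' x - H s x‖ = ‖(H s' x - H s x - (s' - s) • f 0) + (s' - s) • f 0‖ := by
            rw [sub_add_cancel]
        _ ≤ η := (norm_add_le _ _).trans (by linarith)
    · calc _ ≤ η' * ‖x - y‖ := hlip x hx y hy
        _ ≤ η * c * ‖x - y‖ := mul_le_mul_of_nonneg_right (min_le_left _ _) (norm_nonneg _)
        _ = η * (c * ‖x - y‖) := by ring
        _ ≤ η * ‖H s x - H s y‖ := mul_le_mul_of_nonneg_left (hHlow s hs x hx y hy) hη.le
  have hH1 : H 1 = f := by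
    funext x
    simp [H]
  set M := (Matrix.toEuclideanCLM (n := Fin N) (𝕜 := ℝ)).symm (fderiv ℝ f 0) with hM
  have hMf : euclOp M = fderiv ℝ f 0 := by
    rw [hM, euclOp, StarAlgEquiv.apply_symm_apply]
  have hH0 : H 0 = euclOp M ∘ id := by
    funext x
    simp [H, hMf]
  have hdet : M.det ≠ 0 := by
    intro hdet
    obtain ⟨v, hv, hMv⟩ := Matrix.exists_mulVec_eq_zero_iff.2 hdet
    have h1 : euclOp M (WithLp.toLp 2 v) = 0 := by
      rw [euclOp, Matrix.toEuclideanCLM_toLp, hMv]; simp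
    have h2 := hlow0' (WithLp.toLp 2 v)
    rw [← hMf, h1, norm_zero] at h2
    have h3 : ‖WithLp.toLp 2 v‖ = 0 := le_antisymm (by nlinarith) (norm_nonneg _)
    rw [norm_eq_zero] at h3
    exact hv (by simpa using h3)
  rw [hH1, hH0] at hpath
  rcases IsReachableMatrix.of_det_ne_zero (S := S) (i₀ := i₀) hdet id
    ⟨R, fun x hx => mem_closedBall_zero_iff.1 hx⟩ with h | h
  · exact .inl (h.trans hpath)
  · exact .inr (h.trans hpath)

end Linear

/-! ### From chains to residual networks on Euclidean space -/

section ResidualNets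

variable {σ : ℝ → ℝ} {N : ℕ}

local notation "E" => EuclideanSpace ℝ (Fin N)

/-- A map of coordinate vectors, regarded as a map of Euclidean space. -/
def euclMap (f : (Fin N → ℝ) → (Fin N → ℝ)) (x : E) : E := WithLp.toLp 2 (f (WithLp.ofLp x))

/-- A network that is bounded by `δ` and `1/4`-Lipschitz with respect to the Euclidean norm on the
whole space, and of class `C¹` if the activation function is. -/
structure IsSmallNet (σ : ℝ → ℝ) (δ : ℝ) (f : (Fin N → ℝ) → (Fin N → ℝ)) : Prop where
  isNet : IsFeedforwardNet σ f
  contDiff : σ = recuAct → ContDiff ℝ 1 f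
  lipschitz : ∀ x y, ‖euclMap f x - euclMap f y‖ ≤ 1 / 4 * ‖x - y‖
  bounded : ∀ x, ‖euclMap f x‖ ≤ δ

theorem euclidean_norm_le_sum (x : E) : ‖x‖ ≤ ∑ i, |x i| := by
  rw [EuclideanSpace.norm_eq]
  refine Real.sqrt_le_iff.2 ⟨Finset.sum_nonneg fun i _ => abs_nonneg _, ?_⟩
  exact Finset.sum_sq_le_sq_sum_of_nonneg fun i _ => abs_nonneg _

theorem sum_le_card_mul_norm (x : E) : ∑ i, |x i| ≤ N * ‖x‖ := by
  calc ∑ i, |x i| ≤ ∑ _i : Fin N, ‖x‖ := Finset.sum_le_sum fun i _ => PiLp.norm_apply_le x i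
    _ = N * ‖x‖ := by simp

theorem isSmallNet_zero (hσ : IsAdmissibleActivation σ) {δ : ℝ} (hδ : 0 < δ) :
    IsSmallNet σ δ (fun _ : Fin N → ℝ => (0 : Fin N → ℝ)) where
  isNet := isFeedforwardNet_of_netFun hσ.representsId (fun _ _ => 0) fun _ => .const 0
  contDiff _ := contDiff_const
  lipschitz x y := by simp [euclMap]
  bounded x := by simpa [euclMap] using hδ.le

/-- The increment of a sufficiently small step is approximated by a small network. -/
theorem CloseStep.exists_isSmallNet (hσ : IsAdmissibleActivation σ) {α : Type*} {S : Set α}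
    {a b : α → E} {δ η : ℝ} (hδ : 0 < δ) (hη : 0 < η) (hη1 : η * N ^ 2 ≤ 1 / 4)
    (hη2 : N * η ≤ δ / 2) (h : CloseStep S η a b) {D : ℝ} (hD : ∀ x ∈ S, ‖a x‖ ≤ D) {κ : ℝ}
    (hκ : 0 < κ) :
    ∃ f, IsSmallNet σ δ f ∧ ∀ x ∈ S, ‖euclMap f (a x) - (b x - a x)‖ ≤ κ := by
  rcases S.eq_empty_or_nonempty with rfl | ⟨x₀, -⟩
  · exact ⟨_, isSmallNet_zero hσ hδ, by simp⟩
  have : Nonempty α := ⟨x₀⟩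
  set Y : Set (Fin N → ℝ) := (fun x => WithLp.ofLp (a x)) '' S with hY
  have hYt : TotallyBounded Y := by
    refine (isCompact_closedBall (0 : Fin N → ℝ) |D|).totallyBounded.subset ?_
    rintro _ ⟨x, hx, rfl⟩
    rw [mem_closedBall_zero_iff, pi_norm_le_iff_of_nonneg (abs_nonneg _)]
    exact fun i => (PiLp.norm_apply_le (a x) i).trans ((hD x hx).trans (le_abs_self D))
  -- a preimage under `a`; its choice does not affect the increment `b - a`
  have hpre : ∀ y ∈ Y, ∃ x ∈ S, WithLp.ofLp (a x) = y := fun y hy => hy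
  choose! p hpS hpa using hpre
  let g : Fin N → (Fin N → ℝ) → ℝ := fun i y => (b (p y) - a (p y)) i
  have hN : (0 : ℝ) < N + 1 := by positivity
  set κ' := min (κ / (N + 1)) (δ / (2 * (N + 1))) with hκ'
  have hκ'pos : 0 < κ' := lt_min (by positivity) (by positivity)
  have happrox : ∀ i, ∃ H : (Fin N → ℝ) → ℝ, NetFun σ H ∧
      (∀ x x', |H x - H x'| ≤ η * ∑ k, |x k - x' k|) ∧ (∀ x, |H x| ≤ η + κ') ∧
      ∀ y ∈ Y, |H y - g i y| ≤ κ' := by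
    refine fun i => exists_netFun_approx hσ hYt hη.le (fun y hy y' hy' => ?_) hη.le
      (fun y hy => ?_) hκ'pos
    · calc g i y - g i y' ≤ ‖((b (p y) - a (p y)) - (b (p y') - a (p y'))) i‖ := le_abs_self _
        _ ≤ η * ‖a (p y) - a (p y')‖ :=
            (PiLp.norm_apply_le _ i).trans (h.2 _ (hpS y hy) _ (hpS y' hy'))
        _ ≤ η * ∑ k, |y k - y' k| := by
            refine mul_le_mul_of_nonneg_left ((euclidean_norm_le_sum _).trans_eq ?_) hη.le
            refine Finset.sum_congr rfl fun k _ => ?_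
            rw [PiLp.sub_apply, hpa y hy, hpa y' hy']
    · exact (PiLp.norm_apply_le (b (p y) - a (p y)) i).trans (h.1 _ (hpS y hy))
  choose H hH1 hH2 hH3 hH4 using happrox
  refine ⟨fun x i => H i x, ⟨isFeedforwardNet_of_netFun hσ.representsId H hH1, fun hr => ?_,
    fun x y => ?_, fun x => ?_⟩, fun x hx => ?_⟩
  · subst hr
    exact contDiff_pi.2 fun i => (hH1 i).contDiff
  · calc ‖euclMap (fun x i => H i x) x - euclMap (fun x i => H i x) y‖
        ≤ ∑ i : Fin N, |H i (WithLp.ofLp x) - H i (WithLp.ofLp y)| := euclidean_norm_le_sum _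
      _ ≤ ∑ i : Fin N, η * (N * ‖x - y‖) := Finset.sum_le_sum fun i _ =>
          (hH2 i _ _).trans (mul_le_mul_of_nonneg_left (sum_le_card_mul_norm (x - y)) hη.le)
      _ = η * N ^ 2 * ‖x - y‖ := by
          rw [Finset.sum_const, Finset.card_univ, Fintype.card_fin, nsmul_eq_mul]; ring
      _ ≤ 1 / 4 * ‖x - y‖ := mul_le_mul_of_nonneg_right hη1 (norm_nonneg _)
  · calc ‖euclMap (fun x i => H i x) x‖ ≤ ∑ i : Fin N, |H i (WithLp.ofLp x)| :=
          euclidean_norm_le_sum _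
      _ ≤ ∑ i : Fin N, (η + κ') := Finset.sum_le_sum fun i _ => hH3 i _
      _ = N * η + N * κ' := by
          rw [Finset.sum_const, Finset.card_univ, Fintype.card_fin, nsmul_eq_mul]; ring
      _ ≤ δ / 2 + (N + 1) * (δ / (2 * (N + 1))) := by
          refine add_le_add hη2 (mul_le_mul (by linarith) (min_le_right _ _) hκ'pos.le hN.le)
      _ = δ := by field_simp; ring
  · have hy : WithLp.ofLp (a x) ∈ Y := ⟨x, hx, rfl⟩
    have heq : b (p (WithLp.ofLp (a x))) - a (p (WithLp.ofLp (a x))) = b x - a x := by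
      have h1 := h.2 _ (hpS _ hy) _ hx
      have h2 : a (p (WithLp.ofLp (a x))) = a x := WithLp.ofLp_injective 2 (hpa _ hy)
      rw [h2, sub_self, norm_zero, mul_zero] at h1
      rw [h2]
      exact sub_eq_zero.1 (norm_le_zero_iff.1 h1)
    calc ‖euclMap (fun x i => H i x) (a x) - (b x - a x)‖
        ≤ ∑ i : Fin N, |H i (WithLp.ofLp (a x)) - (b x - a x) i| := euclidean_norm_le_sum _
      _ ≤ ∑ i : Fin N, κ' := Finset.sum_le_sum fun i _ => by
          rw [← heq]; exact hH4 i _ hy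
      _ = N * κ' := by rw [Finset.sum_const, Finset.card_univ, Fintype.card_fin, nsmul_eq_mul]
      _ ≤ (N + 1) * (κ / (N + 1)) :=
          mul_le_mul (by linarith) (min_le_left _ _) hκ'pos.le hN.le
      _ = κ := by field_simp

theorem residualComp_congr {X : Type*} [NormedAddCommGroup X] {B B' : ℕ → X → X} {T : ℕ}
    (h : ∀ t, 1 ≤ t → t ≤ T → B t = B' t) :
    residualComp B T = residualComp B' T := by
  induction T with
  | zero => rfl
  | succ T ih =>
    funext x
    rw [residualComp, residualComp, ih fun t h1 h2 => h t h1 (by omega), h (T + 1) (by omega) le_rfl]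

/-- If `a` is connected with `b`, then `b` is approximated by `(Id + h_T) ∘ ⋯ ∘ (Id + h_1) ∘ a` with
small networks `h_t`. -/
theorem Reachable.exists_isSmallNet (hσ : IsAdmissibleActivation σ) {α : Type*} {S : Set α}
    {a b : α → E} (h : Reachable S a b) {δ : ℝ} (hδ : 0 < δ) {D : ℝ} (hD : ∀ x ∈ S, ‖a x‖ ≤ D)
    {κ : ℝ} (hκ : 0 < κ) :
    ∃ (T : ℕ) (f : ℕ → (Fin N → ℝ) → (Fin N → ℝ)), 1 ≤ T ∧ (∀ t, IsSmallNet σ δ (f t)) ∧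
      ∀ x ∈ S, ‖residualComp (fun t => euclMap (f t)) T (a x) - b x‖ ≤ κ := by
  -- the powers of `N` compensate for the passage between the norms `ℓ¹` and `ℓ²`
  set η := min (1 / (4 * (N + 1) ^ 2 : ℝ)) (δ / (2 * (N + 1))) with hη
  have hηpos : 0 < η := lt_min (by positivity) (by positivity)
  have hη1 : η * N ^ 2 ≤ 1 / 4 := by
    calc η * (N : ℝ) ^ 2 ≤ 1 / (4 * (N + 1) ^ 2) * (N + 1) ^ 2 := by
          refine mul_le_mul (min_le_left _ _) ?_ (by positivity) (by positivity)
          gcongr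
          linarith
      _ = 1 / 4 := by field_simp
  have hη2 : N * η ≤ δ / 2 := by
    calc (N : ℝ) * η ≤ (N + 1) * (δ / (2 * (N + 1))) :=
          mul_le_mul (by linarith) (min_le_right _ _) hηpos.le (by positivity)
      _ = δ / 2 := by field_simp
  suffices H : (∃ D, ∀ x ∈ S, ‖b x‖ ≤ D) ∧ ∀ κ > 0,
      ∃ (T : ℕ) (f : ℕ → (Fin N → ℝ) → (Fin N → ℝ)), 1 ≤ T ∧ (∀ t, IsSmallNet σ δ (f t)) ∧
        ∀ x ∈ S, ‖residualComp (fun t => euclMap (f t)) T (a x) - b x‖ ≤ κ from H.2 κ hκ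
  refine Relation.ReflTransGen.rec ?_ (fun {b c} _ hbc ih => ?_) (h η hηpos)
  · refine ⟨⟨D, hD⟩, fun κ hκ => ⟨1, fun _ _ => 0, le_rfl, fun _ => isSmallNet_zero hσ hδ,
      fun x _ => ?_⟩⟩
    have h0 : WithLp.toLp 2 (0 : Fin N → ℝ) = 0 := rfl
    simpa [residualComp, euclMap, h0] using hκ.le
  · obtain ⟨⟨D', hD'⟩, ih⟩ := ih
    refine ⟨⟨D' + η, fun x hx => ?_⟩, fun κ hκ => ?_⟩
    · calc ‖c x‖ = ‖b x + (c x - b x)‖ := by rw [add_sub_cancel]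
        _ ≤ D' + η := (norm_add_le _ _).trans (add_le_add (hD' x hx) (hbc.1 x hx))
    · obtain ⟨T, f, hT, hf, happ⟩ := ih (κ / 4) (by linarith)
      obtain ⟨f', hf', happ'⟩ := hbc.exists_isSmallNet hσ hδ hηpos hη1 hη2 hD'
        (κ := κ / 4) (by linarith)
      refine ⟨T + 1, Function.update f (T + 1) f', by omega, fun t => ?_, fun x hx => ?_⟩
      · by_cases ht : t = T + 1
        · subst ht; simpa using hf'
        · simpa [Function.update_of_ne ht] using hf t
      · have hcongr : residualComp (fun t => euclMap (Function.update f (T + 1) f' t)) T =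
            residualComp (fun t => euclMap (f t)) T :=
          residualComp_congr fun t _ ht => by
            rw [Function.update_of_ne (by omega)]
        rw [residualComp, hcongr]
        simp only [Function.update_self]
        set u := residualComp (fun t => euclMap (f t)) T (a x)
        have h1 := happ x hx
        have h2 := happ' x hx
        have h3 := hf'.lipschitz u (b x)
        calc ‖u + euclMap f' u - c x‖ = ‖(u - b x) + (euclMap f' u - euclMap f' (b x)) +
              (euclMap f' (b x) - (c x - b x))‖ := by congr 1; abel
          _ ≤ κ / 4 + 1 / 4 * (κ / 4) + κ / 4 :=
              norm_add₃_le.trans (by linarith)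
          _ ≤ κ := by linarith

end ResidualNets

/-! ### Encoded networks are neural operators -/

section NeuralOperators

/-- The sequence `m, w 0, w 1, …`. -/
def consSeq (m : ℕ) (w : ℕ → ℕ) : ℕ → ℕ
  | 0 => m
  | ℓ + 1 => w ℓ

variable {d : ℕ} {D : Set (EuclideanSpace ℝ (Fin d))} (φ : HilbertBasis ℕ ℝ (L2Space D))
  {σ : ℝ → ℝ}

/-- The `i`-th component at `x` of `W v + K v + b`, for weights between layers of arbitrary
widths. -/
def opPreActivation {N m n : ℕ} (W : Matrix (Fin m) (Fin n) ℝ) (b : Fin m → ℝ)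
    (K : Fin N → Fin N → Matrix (Fin m) (Fin n) ℝ) (v : Fin n → L2Space D) (i : Fin m)
    (x : EuclideanSpace ℝ (Fin d)) : ℝ :=
  (W *ᵥ fun j => v j x) i + (∑ p, ∑ q, (K p q *ᵥ fun j => ⟪v j, φ p⟫_ℝ) i * φ q x) + b i

theorem coeFn_sum_smul {ι : Type*} (s : Finset ι) (a : ι → ℝ) (f : ι → L2Space D) :
    ⇑(∑ i ∈ s, a i • f i) =ᵐ[volume.restrict D] fun x => ∑ i ∈ s, a i * f i x := by
  classical
  induction s using Finset.induction_on with
  | empty =>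
    filter_upwards [Lp.coeFn_zero ℝ 2 (volume.restrict D)] with x hx
    simpa using hx
  | insert k s hk ih =>
    rw [Finset.sum_insert hk]
    filter_upwards [Lp.coeFn_add (a k • f k) (∑ i ∈ s, a i • f i), Lp.coeFn_smul (a k) (f k), ih]
      with x h1 h2 h3
    rw [h1, Pi.add_apply, h2, h3, Finset.sum_insert hk, Pi.smul_apply, smul_eq_mul]

/-- The constant function `β`, if `φ n₀` is the constant function `c ≠ 0`. -/
def constElem (n₀ : ℕ) (c β : ℝ) : L2Space D := (β / c) • φ n₀

variable {φ} {n₀ : ℕ} {c : ℝ}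

theorem coeFn_constElem (hc : c ≠ 0) (hφ : φ n₀ =ᵐ[volume.restrict D] fun _ => c) (β : ℝ) :
    constElem φ n₀ c β =ᵐ[volume.restrict D] fun _ => β := by
  filter_upwards [hφ, Lp.coeFn_smul (β / c) (φ n₀)] with x h1 h2
  rw [constElem, h2, Pi.smul_apply, h1, smul_eq_mul, div_mul_cancel₀ _ hc]

theorem inner_constElem (β : ℝ) (p : ℕ) :
    ⟪constElem φ n₀ c β, φ p⟫_ℝ = if n₀ = p then β / c else 0 := by
  rw [constElem, real_inner_smul_left, orthonormal_iff_ite.1 φ.orthonormal]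
  simp

theorem const_ne_zero (hφ : φ n₀ =ᵐ[volume.restrict D] fun _ => c) : c ≠ 0 := by
  rintro rfl
  have h : φ n₀ = 0 := (Lp.eq_zero_iff_ae_eq_zero).2 hφ
  have := φ.orthonormal.1 n₀
  rw [h, norm_zero] at this
  exact zero_ne_one this

/-- The layers of a neural operator without the first one: on the constant functions with values
`(1, y)`, they compute `∑ q, (f y) q • φ q`. The additional channel with value `1` replaces the
biases, and turns the bias of the last affine map, which is a vector of coefficients, into a
kernel. -/
theorem IsFeedforwardNet.exists_operator_tail (hσ1 : σ 1 = 1) (hc : c ≠ 0)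
    (hφ : φ n₀ =ᵐ[volume.restrict D] fun _ => c) {n m : ℕ} {f : (Fin n → ℝ) → (Fin m → ℝ)}
    (hf : IsFeedforwardNet σ f) (hm : n₀ < m) :
    ∃ (L : ℕ) (w : ℕ → ℕ)
      (W : ∀ ℓ, Matrix (Fin (consSeq (n + 1) w (ℓ + 1))) (Fin (consSeq (n + 1) w ℓ)) ℝ)
      (b : ∀ ℓ, Fin (consSeq (n + 1) w (ℓ + 1)) → ℝ)
      (K : ∀ ℓ, Fin m → Fin m →
        Matrix (Fin (consSeq (n + 1) w (ℓ + 1))) (Fin (consSeq (n + 1) w ℓ)) ℝ),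
      w L = 1 ∧ ∀ y : Fin n → ℝ, ∃ v : ∀ ℓ, Fin (consSeq (n + 1) w ℓ) → L2Space D,
        (∀ i : Fin (n + 1), v 0 i = constElem φ n₀ c ((Fin.cons 1 y : Fin (n + 1) → ℝ) i)) ∧
        (∀ ℓ < L, ∀ i, v (ℓ + 1) i =ᵐ[volume.restrict D]
          fun x => σ (opPreActivation φ (W ℓ) (b ℓ) (K ℓ) (v ℓ) i x)) ∧
        (∀ i, v (L + 1) i =ᵐ[volume.restrict D]
          fun x => opPreActivation φ (W L) (b L) (K L) (v L) i x) ∧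
        ∀ i, v (L + 1) i = decoder φ m (f y) := by
  induction hf with
  | @affine n m W b =>
    let K₀ : Fin m → Fin m → Matrix (Fin 1) (Fin (n + 1)) ℝ := fun p q =>
      if n₀ = p then Matrix.of fun _ => c • (Fin.cons (b q) (W q) : Fin (n + 1) → ℝ) else 0
    refine ⟨0, fun _ => 1, fun _ => 0, fun _ => 0, fun ℓ => match ℓ with
      | 0 => K₀
      | _ + 1 => 0, rfl, fun y => ⟨fun ℓ => match ℓ with
        | 0 => fun i => constElem φ n₀ c ((Fin.cons 1 y : Fin (n + 1) → ℝ) i)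
        | _ + 1 => fun _ => decoder φ m (W *ᵥ y + b), fun i => rfl, fun ℓ hℓ => absurd hℓ (by simp),
        fun i => ?_, fun i => rfl⟩⟩
    have hK : ∀ p q, (K₀ p q *ᵥ fun j =>
        ⟪constElem φ n₀ c ((Fin.cons 1 y : Fin (n + 1) → ℝ) j), φ p⟫_ℝ) =
        fun _ => if p = ⟨n₀, hm⟩ then (W *ᵥ y + b) q else 0 := by
      intro p q
      funext i
      by_cases hp : n₀ = p
      · have hp' : p = ⟨n₀, hm⟩ := Fin.ext hp.symm
        simp only [K₀, if_pos hp, if_pos hp', inner_constElem, Matrix.mulVec, dotProduct,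
          Matrix.of_apply, Fin.sum_univ_succ, Pi.smul_apply, smul_eq_mul, Fin.cons_zero,
          Fin.cons_succ, Pi.add_apply]
        rw [add_comm]
        congr 1
        · exact Finset.sum_congr rfl fun j _ => by field_simp
        · field_simp
      · have hp' : p ≠ ⟨n₀, hm⟩ := fun h => hp (by rw [h])
        simp [K₀, hp, hp']
    refine (coeFn_sum_smul Finset.univ (W *ᵥ y + b) fun q : Fin m => φ q).trans ?_
    filter_upwards with x
    have hpre : ∀ i : Fin 1, opPreActivation φ (0 : Matrix (Fin 1) (Fin (n + 1)) ℝ) 0 K₀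
        (fun j => constElem φ n₀ c ((Fin.cons 1 y : Fin (n + 1) → ℝ) j)) i x =
        ∑ q, (W *ᵥ y + b) q * φ q x := by
      intro i
      simp only [opPreActivation, Matrix.zero_mulVec, Pi.zero_apply, zero_add, add_zero, hK,
        ite_mul, zero_mul]
      rw [Finset.sum_comm]
      simp
    exact (hpre i).symm
  | @layer n k m W b f _ ih =>
    obtain ⟨L, w, Ws, bs, Ks, hw, H⟩ := ih hm
    let W₀ : Matrix (Fin (k + 1)) (Fin (n + 1)) ℝ := Matrix.of
      (Fin.cons (Pi.single 0 1) fun i => (Fin.cons (b i) (W i) : Fin (n + 1) → ℝ))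
    refine ⟨L + 1, consSeq (k + 1) w, fun ℓ => match ℓ with
      | 0 => W₀
      | ℓ + 1 => Ws ℓ, fun ℓ => match ℓ with
      | 0 => (0 : Fin (k + 1) → ℝ)
      | ℓ + 1 => bs ℓ, fun ℓ => match ℓ with
      | 0 => (0 : Fin m → Fin m → Matrix (Fin (k + 1)) (Fin (n + 1)) ℝ)
      | ℓ + 1 => Ks ℓ, hw, fun y => ?_⟩
    obtain ⟨v, hv0, hv, hvL, hvf⟩ := H fun i => σ ((W *ᵥ y + b) i)
    refine ⟨fun ℓ => match ℓ with
      | 0 => fun i => constElem φ n₀ c ((Fin.cons 1 y : Fin (n + 1) → ℝ) i)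
      | ℓ + 1 => v ℓ, fun i => rfl, fun ℓ hℓ => ?_, hvL, hvf⟩
    cases ℓ with
    | succ ℓ => exact hv ℓ (by omega)
    | zero =>
      intro i
      refine (EventuallyEq.of_eq (congrArg (fun g : L2Space D => ⇑g) (hv0 i))).trans ?_
      refine (coeFn_constElem hc hφ _).trans ?_
      have hall : ∀ᵐ x ∂(volume.restrict D), ∀ j : Fin (n + 1),
          constElem φ n₀ c ((Fin.cons 1 y : Fin (n + 1) → ℝ) j) x =
            (Fin.cons 1 y : Fin (n + 1) → ℝ) j :=
        ae_all_iff.2 fun j => coeFn_constElem hc hφ _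
      filter_upwards [hall] with x hx
      have hpre : ∀ i : Fin (k + 1), opPreActivation φ W₀ 0
          (0 : Fin m → Fin m → Matrix (Fin (k + 1)) (Fin (n + 1)) ℝ)
          (fun i => constElem φ n₀ c ((Fin.cons 1 y : Fin (n + 1) → ℝ) i)) i x =
          (Fin.cons 1 (W *ᵥ y + b) : Fin (k + 1) → ℝ) i := by
        intro i
        simp only [opPreActivation, hx, Pi.zero_apply, Matrix.zero_mulVec, zero_mul,
          Finset.sum_const_zero, add_zero]
        refine Fin.cases ?_ (fun i => ?_) i
        · simp [W₀, Matrix.mulVec, dotProduct, Fin.sum_univ_succ]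
        · simp [W₀, Matrix.mulVec, dotProduct, Fin.sum_univ_succ, add_comm]
      refine Eq.trans ?_ (congrArg σ (hpre i).symm)
      refine Fin.cases ?_ (fun i => ?_) i
      · simp [hσ1]
      · simp

/-- The first layer replaces the input `u` by constant functions with the values `⟪u, φ p⟫`. -/
theorem mem_neuralOperatorClass (hσ1 : σ 1 = 1) (hφ : φ n₀ =ᵐ[volume.restrict D] fun _ => c)
    {N : ℕ} (hN : n₀ < N) (hid : RepresentsId σ) {f : (Fin N → ℝ) → (Fin N → ℝ)}
    (hf : IsFeedforwardNet σ f) :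
    ∃ L, 1 ≤ L ∧ (fun u => decoder φ N (f (encoder φ N u))) ∈ NeuralOperatorClass L N φ σ := by
  have hc := const_ne_zero hφ
  obtain ⟨k, W, b, g, hg, rfl⟩ := hf.exists_layer hid
  obtain ⟨L, w, Ws, bs, Ks, hw, H⟩ := hg.exists_operator_tail hσ1 hc hφ hN
  let K₀ : Fin N → Fin N → Matrix (Fin (k + 1)) (Fin 1) ℝ := fun p q =>
    if q = ⟨n₀, hN⟩ then Matrix.of fun i _ => (Fin.cons 0 fun i => W i p / c : Fin (k + 1) → ℝ) i
    else 0
  let P : NeuralOperatorParams (L + 1) N :=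
    { width := consSeq 1 (consSeq (k + 1) w)
      width_zero := rfl
      width_last := hw
      W := fun ℓ => match ℓ with
        | 0 => (0 : Matrix (Fin (k + 1)) (Fin 1) ℝ)
        | ℓ + 1 => Ws ℓ
      b := fun ℓ => match ℓ with
        | 0 => (Fin.cons 1 b : Fin (k + 1) → ℝ)
        | ℓ + 1 => bs ℓ
      K := fun ℓ => match ℓ with
        | 0 => K₀
        | ℓ + 1 => Ks ℓ }
  refine ⟨L + 1, by omega, P, fun u => ?_⟩
  obtain ⟨v, hv0, hv, hvL, hvf⟩ := H fun i => σ ((W *ᵥ encoder φ N u + b) i)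
  refine ⟨fun ℓ => match ℓ with
    | 0 => fun _ => u
    | ℓ + 1 => v ℓ, fun i => rfl, fun ℓ hℓ => ?_, hvL, fun i => (hvf i).symm⟩
  cases ℓ with
  | succ ℓ => exact hv ℓ (by omega)
  | zero =>
    intro i
    refine (EventuallyEq.of_eq (congrArg (fun g : L2Space D => ⇑g) (hv0 i))).trans ?_
    refine (coeFn_constElem hc hφ _).trans ?_
    filter_upwards [hφ] with x hx
    have hpre : ∀ i : Fin (k + 1), opPreActivation φ (0 : Matrix (Fin (k + 1)) (Fin 1) ℝ)
        (Fin.cons 1 b : Fin (k + 1) → ℝ) K₀ (fun _ => u) i x =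
        (Fin.cons 1 (W *ᵥ encoder φ N u + b) : Fin (k + 1) → ℝ) i := by
      intro i
      have hsum : ∑ p, ∑ q : Fin N, (K₀ p q *ᵥ fun _ => ⟪u, φ p⟫_ℝ) i * φ q x =
          (Fin.cons 0 (W *ᵥ encoder φ N u) : Fin (k + 1) → ℝ) i := by
        have h1 : ∀ p q : Fin N, (K₀ p q *ᵥ fun _ => ⟪u, φ p⟫_ℝ) i * φ q x =
            if q = ⟨n₀, hN⟩ then
              (Fin.cons 0 fun i => W i p * ⟪u, φ p⟫_ℝ : Fin (k + 1) → ℝ) i else 0 := by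
          intro p q
          by_cases hq : q = ⟨n₀, hN⟩
          · rw [if_pos hq]
            subst hq
            simp only [K₀, if_true, Matrix.mulVec, dotProduct, Matrix.of_apply, hx]
            refine Fin.cases ?_ (fun i => ?_) i
            · simp
            · simp only [Fin.cons_succ, Finset.univ_unique, Finset.sum_singleton]
              field_simp
          · simp [K₀, hq]
        simp only [h1, Finset.sum_ite_eq', Finset.mem_univ, if_true]
        refine Fin.cases ?_ (fun i => ?_) i
        · simp
        · simp [Matrix.mulVec, dotProduct, encoder]
      unfold opPreActivation
      rw [hsum]
      refine Fin.cases ?_ (fun i => ?_) i <;> simp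
    refine Eq.trans ?_ (congrArg σ (hpre i).symm)
    refine Fin.cases ?_ (fun i => ?_) i
    · simp [hσ1]
    · simp

end NeuralOperators

/-! ### Contractive perturbations of the identity -/

section Perturbation

variable {X : Type*} [NormedAddCommGroup X]

/-- `L` inverts `Id + B` and is the limit of the fixed-point iteration `x ↦ y - B x`. -/
structure IsPerturbationInverse (B L : X → X) : Prop where
  right : ∀ y, L y + B (L y) = y
  left : ∀ x, L (x + B x) = x
  continuous : Continuous L
  tendsto : ∀ y, Tendsto (fun n : ℕ => ((inversionStep B)^[n] (0, y)).1) atTop (𝓝 (L y))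

theorem iterate_inversionStep (B : X → X) (y : X) (n : ℕ) :
    (inversionStep B)^[n] (0, y) = ((fun x => y - B x)^[n] 0, y) := by
  induction n with
  | zero => rfl
  | succ n ih => rw [Function.iterate_succ_apply', ih, Function.iterate_succ_apply']; rfl

variable {B : X → X} (hB : ∀ x y, ‖B x - B y‖ ≤ 1 / 4 * ‖x - y‖)

include hB

theorem exists_isPerturbationInverse [CompleteSpace X] : ∃ L, IsPerturbationInverse B L := by
  have hc : ∀ y, ContractingWith (1 / 4) fun x => y - B x := fun y =>
    ⟨by rw [← NNReal.coe_lt_coe]; norm_num, LipschitzWith.of_dist_le_mul fun x x' => by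
      rw [dist_eq_norm, dist_eq_norm, sub_sub_sub_cancel_left, norm_sub_rev]
      simpa using hB x x'⟩
  let L : X → X := fun y => ContractingWith.fixedPoint _ (hc y)
  have hright : ∀ y, L y + B (L y) = y := fun y => by
    have : y - B (L y) = L y := (hc y).fixedPoint_isFixedPt
    exact eq_sub_iff_add_eq.1 this.symm
  have hleft : ∀ x, L (x + B x) = x := fun x =>
    ((hc (x + B x)).fixedPoint_unique (add_sub_cancel_right x (B x))).symm
  refine ⟨L, hright, hleft, ?_, fun y => ?_⟩
  · refine (LipschitzWith.of_dist_le_mul (K := 4 / 3) fun y y' => ?_).continuous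
    rw [dist_eq_norm, dist_eq_norm]
    have h1 : L y - L y' = (y - y') - (B (L y) - B (L y')) := by
        rw [sub_sub_sub_comm, sub_eq_of_eq_add (hright y).symm, sub_eq_of_eq_add (hright y').symm]
    have h2 := hB (L y) (L y')
    have h3 : ‖L y - L y'‖ ≤ ‖y - y'‖ + ‖B (L y) - B (L y')‖ := by
      conv_lhs => rw [h1]
      exact norm_sub_le _ _
    push_cast
    linarith
  · simp only [iterate_inversionStep]
    exact (hc y).tendsto_iterate_fixedPoint 0

variable [InnerProductSpace ℝ X]

theorem stronglyMonotoneOn_of_contraction (s : Set X) : StronglyMonotoneOn (fun x => x + B x) s := by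
  refine ⟨3 / 4, by norm_num, fun x _ y _ => ?_⟩
  have h1 : (x + B x) - (y + B y) = (x - y) + (B x - B y) := by abel
  have h2 := abs_le.1 ((abs_real_inner_le_norm (B x - B y) (x - y)).trans
    (mul_le_mul_of_nonneg_right (hB x y) (norm_nonneg _)))
  rw [h1, inner_add_left, real_inner_self_eq_norm_sq]
  nlinarith [h2.1]

theorem contDiff_perturbationInverse [CompleteSpace X] (hBd : ContDiff ℝ 1 B) {L : X → X}
    (hL : IsPerturbationInverse B L) : ContDiff ℝ 1 L := by
  let e : X ≃ₜ X :=
    { toFun := fun x => x + B x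
      invFun := L
      left_inv := hL.left
      right_inv := hL.right
      continuous_toFun := continuous_id.add hBd.continuous
      continuous_invFun := hL.continuous }
  have hnorm : ∀ x, ‖-fderiv ℝ B x‖ < 1 := fun x => by
    rw [norm_neg]
    refine (norm_fderiv_le_of_lip' ℝ (C := 1 / 4) (by norm_num)
      (Eventually.of_forall fun y => hB y x)).trans_lt (by norm_num)
  refine e.contDiff_symm (f₀' := fun x => ContinuousLinearEquiv.unitsEquiv ℝ X
    (Units.oneSub (-fderiv ℝ B x) (hnorm x))) (fun x => ?_) (contDiff_id.add hBd)
  have h1 : HasFDerivAt (fun x => x + B x) (ContinuousLinearMap.id ℝ X + fderiv ℝ B x) x :=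
    (hasFDerivAt_id x).add (hBd.differentiable one_ne_zero x).hasFDerivAt
  refine h1.congr_fderiv ?_
  ext v
  simp [Units.oneSub]

theorem isC1DiffeoOn_perturbation [CompleteSpace X] (hBd : ContDiff ℝ 1 B) {s : Set X}
    (hs : IsOpen s) : IsC1DiffeoOn (fun x => x + B x) s := by
  obtain ⟨L, hL⟩ := exists_isPerturbationInverse hB
  let e : X ≃ₜ X :=
    { toFun := fun x => x + B x
      invFun := L
      left_inv := hL.left
      right_inv := hL.right
      continuous_toFun := continuous_id.add hBd.continuous
      continuous_invFun := hL.continuous }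
  exact ⟨e.toOpenPartialHomeomorphOfImageEq s hs _ rfl, rfl, fun x _ => rfl,
    (contDiff_id.add hBd).contDiffOn, (contDiff_perturbationInverse hB hBd hL).contDiffOn⟩

omit hB

/-- If `B` factors through the compact operator `Q` on both sides, then so does the perturbation
`L - Id = -B ∘ L`. -/
theorem isNeuralOperatorLayer_perturbationInverse {L : X → X} (hL : IsPerturbationInverse B L)
    (hBd : ContDiff ℝ 1 B) (hLd : ContDiff ℝ 1 L) {Q : X →L[ℝ] X} (hQ : IsCompactOperator Q)
    (hQB : ∀ x, Q (B x) = B x) (hBQ : ∀ x, B (Q x) = B x) : IsNeuralOperatorLayer L := by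
  refine ⟨Q, Q, fun z => -B (L z), hQ, hQ, (hBd.comp hLd).neg, fun y => ?_⟩
  have h1 : L (Q y) = Q (L y) := by
    conv_lhs => rw [← hL.right y, map_add, hQB, ← hBQ, hL.left]
  beta_reduce
  rw [h1, map_neg, hQB, hBQ, ← sub_eq_add_neg, eq_sub_iff_add_eq]
  exact hL.right y

end Perturbation

/-! ### Compositions of blocks -/

section Blocks

variable {X : Type*} [NormedAddCommGroup X] {B L : ℕ → X → X}

theorem norm_residualComp_lt {δ : ℝ} (hδ : ∀ t x, ‖B t x‖ ≤ δ) {R : ℝ} {x : X} (hx : ‖x‖ < R)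
    (t : ℕ) : ‖residualComp B t x‖ < R + t * δ := by
  induction t with
  | zero => simpa [residualComp] using hx
  | succ t ih =>
    rw [residualComp]
    refine (norm_add_le _ _).trans_lt ?_
    push_cast
    linarith [hδ (t + 1) (residualComp B t x)]

section Inverse

variable (h : ∀ t, IsPerturbationInverse (B t) (L t))

include h

theorem reverseComp_residualComp (T : ℕ) (x : X) : reverseComp L T (residualComp B T x) = x := by
  induction T with
  | zero => rfl
  | succ T ih => rw [reverseComp, residualComp, Function.comp_apply, (h (T + 1)).left, ih]

theorem continuous_reverseComp (T : ℕ) : Continuous (reverseComp L T) := by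
  induction T with
  | zero => exact continuous_id
  | succ T ih => exact ih.comp (h (T + 1)).continuous

end Inverse

variable [InnerProductSpace ℝ X]

/-- The composition of layers numbers its factors in the order opposite to `reverseComp`. -/
theorem reverseComp_comp_layerComp (T : ℕ) : ∀ k ≤ T,
    reverseComp L (T - k) ∘ layerComp id (fun _ => ContinuousLinearMap.id ℝ X)
      (fun ℓ => L (T + 1 - ℓ)) k = reverseComp L T := by
  intro k
  induction k with
  | zero => exact fun _ => rfl
  | succ k ih =>
    intro hk
    rw [← ih (by omega)]
    obtain ⟨m, hm⟩ : ∃ m, T - k = m + 1 := ⟨T - k - 1, by omega⟩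
    have h1 : T - (k + 1) = m := by omega
    have h2 : T + 1 - (k + 1) = m + 1 := by omega
    funext x
    simp only [Function.comp_apply, layerComp, h1, h2, hm, reverseComp]
    rfl

theorem isGeneralizedNeuralOperator_reverseComp {T : ℕ} (hT : 1 ≤ T)
    (hL : ∀ t, IsNeuralOperatorLayer (L t)) :
    IsGeneralizedNeuralOperator (reverseComp L T) := by
  refine ⟨T, id, fun _ => ContinuousLinearMap.id ℝ X, fun ℓ => L (T + 1 - ℓ), hT, continuous_id,
    fun ℓ _ _ => hL _, ?_⟩
  rw [← reverseComp_comp_layerComp (L := L) T T le_rfl, Nat.sub_self]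
  rfl

/-- A continuous map is a generalized neural operator, with the map itself as the operation `S`. -/
theorem isGeneralizedNeuralOperator_of_continuous {Φ : X → X} (hΦ : Continuous Φ) :
    IsGeneralizedNeuralOperator Φ :=
  ⟨1, Φ, fun _ => ContinuousLinearMap.id ℝ X, fun _ => id, le_rfl, hΦ,
    fun _ _ _ => ⟨0, 0, 0, isCompactOperator_zero, isCompactOperator_zero, contDiff_const,
      fun x => by simp⟩, rfl⟩

end Blocks

/-! ### Reduction to finitely many coordinates -/

section Reduction

variable {X : Type*} [NormedAddCommGroup X] [InnerProductSpace ℝ X]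

theorem totallyBounded_image_closedBall {T : X →L[ℝ] X} (hT : IsCompactOperator T) (r : ℝ) :
    TotallyBounded (T '' Metric.closedBall 0 r) :=
  (IsCompactOperator.isCompact_closure_image_closedBall (f := T.toLinearMap) hT
    r).totallyBounded.subset subset_closure

variable (φ : HilbertBasis ℕ ℝ X) (N : ℕ)

theorem inner_decoder (α β : Fin N → ℝ) :
    ⟪decoder φ N α, decoder φ N β⟫_ℝ = ∑ n, α n * β n := by
  have h : Orthonormal ℝ fun n : Fin N => φ n := φ.orthonormal.comp _ Fin.val_injective
  simpa [decoder] using h.inner_sum α β Finset.univ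

/-- The decoder as a linear isometry of Euclidean space into `X`. -/
def euclDecoder : EuclideanSpace ℝ (Fin N) →ₗᵢ[ℝ] X where
  toFun z := decoder φ N (WithLp.ofLp z)
  map_add' x y := by simp [decoder, add_smul, Finset.sum_add_distrib]
  map_smul' a x := by simp [decoder, mul_smul, Finset.smul_sum]
  norm_map' x := by
    change ‖decoder φ N (WithLp.ofLp x)‖ = ‖x‖
    rw [EuclideanSpace.norm_eq, norm_eq_sqrt_real_inner, inner_decoder]
    simp [sq]

/-- The encoder as a bounded linear map from `X` to Euclidean space. -/
def euclEncoder [CompleteSpace X] : X →L[ℝ] EuclideanSpace ℝ (Fin N) :=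
  (euclDecoder φ N).toContinuousLinearMap.adjoint

theorem euclDecoder_apply (z : EuclideanSpace ℝ (Fin N)) :
    euclDecoder φ N z = decoder φ N (WithLp.ofLp z) := rfl

variable [CompleteSpace X]

theorem inner_euclEncoder (x : X) (z : EuclideanSpace ℝ (Fin N)) :
    ⟪euclEncoder φ N x, z⟫_ℝ = ⟪x, euclDecoder φ N z⟫_ℝ :=
  ContinuousLinearMap.adjoint_inner_left _ z x

theorem ofLp_euclEncoder (x : X) : WithLp.ofLp (euclEncoder φ N x) = encoder φ N x := by
  funext n
  have h := inner_euclEncoder φ N x (EuclideanSpace.single n 1)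
  rw [EuclideanSpace.inner_single_right, euclDecoder_apply] at h
  have h2 : decoder φ N (WithLp.ofLp (EuclideanSpace.single n (1 : ℝ))) = φ n := by
    simp only [decoder, PiLp.single_apply, ite_smul, one_smul, zero_smul]
    simp
  rw [h2] at h
  simpa [encoder] using h

theorem euclEncoder_euclDecoder (z : EuclideanSpace ℝ (Fin N)) :
    euclEncoder φ N (euclDecoder φ N z) = z := by
  refine ext_inner_right ℝ fun w => ?_
  rw [inner_euclEncoder, LinearIsometry.inner_map_map]

/-- The orthogonal projection onto the span of the first `N` basis elements. -/
def basisProj : X →L[ℝ] X :=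
  (euclDecoder φ N).toContinuousLinearMap ∘L euclEncoder φ N

theorem basisProj_apply (x : X) : basisProj φ N x = euclDecoder φ N (euclEncoder φ N x) := rfl

theorem isCompactOperator_basisProj : IsCompactOperator (basisProj φ N) := by
  have h : IsCompactOperator (euclEncoder φ N) :=
    isCompactOperator_of_locallyCompactSpace_dom (euclEncoder φ N)
  exact h.clm_comp (euclDecoder φ N).toContinuousLinearMap

theorem inner_basisProj (x y : X) : ⟪basisProj φ N x, y⟫_ℝ = ⟪x, basisProj φ N y⟫_ℝ := by
  rw [basisProj_apply, basisProj_apply, ← inner_euclEncoder, real_inner_comm, ← inner_euclEncoder,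
    real_inner_comm]

theorem basisProj_basisProj (x : X) : basisProj φ N (basisProj φ N x) = basisProj φ N x := by
  rw [basisProj_apply, basisProj_apply, euclEncoder_euclDecoder]

theorem norm_basisProj_le (x : X) : ‖basisProj φ N x‖ ≤ ‖x‖ := by
  have h1 : ‖basisProj φ N x‖ ^ 2 = ⟪x, basisProj φ N x⟫_ℝ := by
    rw [← real_inner_self_eq_norm_sq, inner_basisProj, basisProj_basisProj]
  have h2 := real_inner_le_norm x (basisProj φ N x)
  by_contra! h
  nlinarith [norm_nonneg x, norm_nonneg (basisProj φ N x)]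

theorem norm_sub_basisProj_le (x : X) : ‖x - basisProj φ N x‖ ≤ ‖x‖ := by
  have h1 : ‖x - basisProj φ N x‖ ^ 2 = ⟪x, x - basisProj φ N x⟫_ℝ := by
    rw [← real_inner_self_eq_norm_sq, inner_sub_left, inner_basisProj, map_sub,
      basisProj_basisProj, sub_self, inner_zero_right, sub_zero]
  have h2 := real_inner_le_norm x (x - basisProj φ N x)
  by_contra! h
  nlinarith [norm_nonneg x, norm_nonneg (x - basisProj φ N x)]

theorem norm_euclEncoder_le (x : X) : ‖euclEncoder φ N x‖ ≤ ‖x‖ := by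
  rw [← (euclDecoder φ N).norm_map, ← basisProj_apply]
  exact norm_basisProj_le φ N x

theorem tendsto_basisProj (x : X) : Tendsto (fun N => basisProj φ N x) atTop (𝓝 x) := by
  have h := (φ.hasSum_repr x).tendsto_sum_nat
  refine h.congr fun N => ?_
  rw [basisProj_apply, euclDecoder_apply, ofLp_euclEncoder, decoder, Finset.sum_range]
  refine Finset.sum_congr rfl fun n _ => ?_
  rw [φ.repr_apply_apply, encoder, real_inner_comm]

/-- The projections converge uniformly on totally bounded sets. -/
theorem eventually_norm_sub_basisProj_le {Y : Set X} (hY : TotallyBounded Y) {ε : ℝ} (hε : 0 < ε) :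
    ∀ᶠ N in atTop, ∀ y ∈ Y, ‖y - basisProj φ N y‖ ≤ ε := by
  obtain ⟨t, htf, hcov⟩ := Metric.totallyBounded_iff.1 hY (ε / 2) (by linarith)
  have h1 : ∀ᶠ N in atTop, ∀ z ∈ t, ‖z - basisProj φ N z‖ < ε / 2 := by
    refine (htf.eventually_all).2 fun z _ => ?_
    have := Metric.tendsto_nhds.1 (tendsto_basisProj φ z) (ε / 2) (by linarith)
    filter_upwards [this] with N hN
    rwa [← dist_eq_norm, dist_comm]
  filter_upwards [h1] with N hN y hy
  obtain ⟨z, hz, hyz⟩ := Set.mem_iUnion₂.1 (hcov hy)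
  have h2 : y - basisProj φ N y =
      ((y - z) - basisProj φ N (y - z)) + (z - basisProj φ N z) := by
    rw [map_sub]; abel
  rw [h2]
  have h3 := norm_sub_basisProj_le φ N (y - z)
  have h4 := hN z hz
  rw [mem_ball_iff_norm] at hyz
  exact (norm_add_le _ _).trans (by linarith)

theorem eventually_norm_apply_sub_basisProj_le {T : X →L[ℝ] X} (hT : IsCompactOperator T) {ε : ℝ}
    (hε : 0 < ε) : ∀ᶠ N in atTop, ∀ x, ‖T x - basisProj φ N (T x)‖ ≤ ε * ‖x‖ := by
  filter_upwards [eventually_norm_sub_basisProj_le φ (totallyBounded_image_closedBall hT 1) hε]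
    with N hN x
  rcases eq_or_ne x 0 with rfl | hx
  · simp
  have hx' : 0 < ‖x‖ := norm_pos_iff.2 hx
  have h1 := hN (T (‖x‖⁻¹ • x)) ⟨_, by
    rw [mem_closedBall_zero_iff, norm_smul, norm_inv, norm_norm, inv_mul_cancel₀ hx'.ne'], rfl⟩
  rw [map_smul, map_smul, ← smul_sub, norm_smul, norm_inv, norm_norm, inv_mul_le_iff₀ hx'] at h1
  linarith

/-- A compact operator is uniformly small on the tails of vectors of bounded norm: for
`z = T (x - Π x)` one has `‖z‖² = ⟪x, (1 - Π) (T† z)⟫`, where `T† z` ranges over a totally bounded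
set. -/
theorem eventually_norm_apply_tail_le {T : X →L[ℝ] X} (hT : IsCompactOperator T) {R ε : ℝ}
    (hR : 0 < R) (hε : 0 < ε) :
    ∀ᶠ N in atTop, ∀ x ∈ Metric.closedBall (0 : X) R, ‖T (x - basisProj φ N x)‖ ≤ ε := by
  have htb : TotallyBounded (T.adjoint '' (T '' Metric.closedBall 0 R)) :=
    (totallyBounded_image_closedBall hT R).image T.adjoint.uniformContinuous
  filter_upwards [eventually_norm_sub_basisProj_le φ htb (ε := ε ^ 2 / R) (by positivity)]
    with N hN x hx
  set z := T (x - basisProj φ N x) with hz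
  have hx' := mem_closedBall_zero_iff.1 hx
  have h1 := hN (T.adjoint z) ⟨z, ⟨_, by
    rw [mem_closedBall_zero_iff]
    exact (norm_sub_basisProj_le φ N x).trans hx', rfl⟩, rfl⟩
  have h2 : ‖z‖ ^ 2 = ⟪x, T.adjoint z - basisProj φ N (T.adjoint z)⟫_ℝ := by
    rw [← real_inner_self_eq_norm_sq]
    conv_lhs => rw [hz]
    rw [← ContinuousLinearMap.adjoint_inner_right, ← hz, inner_sub_left, inner_sub_right,
      inner_basisProj]
  have h3 : ‖z‖ ^ 2 ≤ ε ^ 2 := by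
    calc ‖z‖ ^ 2 ≤ ‖x‖ * ‖T.adjoint z - basisProj φ N (T.adjoint z)‖ :=
          h2.trans_le (real_inner_le_norm _ _)
      _ ≤ R * (ε ^ 2 / R) := mul_le_mul hx' h1 (norm_nonneg _) hR.le
      _ = ε ^ 2 := by field_simp
  exact abs_le_of_sq_le_sq' h3 hε.le |>.2

/-- On a ball, a bilipschitz layer is uniformly close to `(Id - Π) + f ∘ Π`, where `f` is a `C¹` map
of the range of a coordinate projection `Π` which is bounded below on the ball. -/
theorem IsBilipschitzLayer.exists_finite_dimensional {F : X → X} (hF : IsBilipschitzLayer F) {R : ℝ}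
    (hR : 0 < R) {κ : ℝ} (hκ : 0 < κ) (N₀ : ℕ) :
    ∃ N, N₀ ≤ N ∧ ∃ (f : EuclideanSpace ℝ (Fin N) → EuclideanSpace ℝ (Fin N)) (c : ℝ),
      ContDiff ℝ 1 f ∧ 0 < c ∧
      (∀ z ∈ Metric.closedBall (0 : EuclideanSpace ℝ (Fin N)) R,
        ∀ w ∈ Metric.closedBall (0 : EuclideanSpace ℝ (Fin N)) R,
          c * ‖z - w‖ ≤ ‖f z - f w‖) ∧
      ∀ x ∈ Metric.closedBall (0 : X) R,
        ‖F x - (x - basisProj φ N x + euclDecoder φ N (f (euclEncoder φ N x)))‖ ≤ κ := by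
  obtain ⟨⟨T₁, T₂, G, hT₁, hT₂, hG, hFG⟩, c, C, hc, hbi⟩ := hF
  -- `G` is bounded and Lipschitz on the image of the ball under `T₁`, which is relatively compact
  set Y := T₁ '' Metric.closedBall (0 : X) R with hY
  have hYc : IsCompact (closure Y) :=
    IsCompactOperator.isCompact_closure_image_closedBall (f := T₁.toLinearMap) hT₁ R
  have hYconv : Convex ℝ Y := (convex_closedBall (0 : X) R).linear_image T₁.toLinearMap
  obtain ⟨M, hM⟩ := hYc.exists_bound_of_continuousOn (hG.continuous_fderiv one_ne_zero).continuousOn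
  obtain ⟨M', hM'⟩ := hYc.exists_bound_of_continuousOn hG.continuous.continuousOn
  have hlip : ∀ x ∈ Metric.closedBall (0 : X) R, ∀ y ∈ Metric.closedBall (0 : X) R,
      ‖G (T₁ x) - G (T₁ y)‖ ≤ |M| * ‖T₁ x - T₁ y‖ := fun x hx y hy =>
    Convex.norm_image_sub_le_of_norm_fderiv_le (𝕜 := ℝ) (s := Y)
      (fun z _ => hG.differentiable one_ne_zero z)
      (fun z hz => (hM z (subset_closure hz)).trans (le_abs_self M)) hYconv ⟨y, hy, rfl⟩ ⟨x, hx, rfl⟩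
  have hbd : ∀ x ∈ Metric.closedBall (0 : X) R, ‖G (T₁ x)‖ ≤ |M'| := fun x hx =>
    (hM' _ (subset_closure ⟨x, hx, rfl⟩)).trans (le_abs_self M')
  set ε₁ := min (c / (2 * (|M| * ‖T₁‖ + 1))) (κ / (2 * (|M'| + 1))) with hε₁
  have hε₁pos : 0 < ε₁ := lt_min (by positivity) (by positivity)
  set ε₂ := κ / (2 * (‖T₂‖ * |M| + 1)) with hε₂
  have hε₂pos : 0 < ε₂ := by positivity
  obtain ⟨N, hN1, hN2, hN⟩ := ((eventually_norm_apply_sub_basisProj_le φ hT₂ hε₁pos).and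
    ((eventually_norm_apply_tail_le φ hT₁ hR hε₂pos).and (eventually_ge_atTop N₀))).exists
  refine ⟨N, hN, fun z => z + euclEncoder φ N (T₂ (G (T₁ (euclDecoder φ N z)))), c / 2, ?_,
    by linarith, fun z hz w hw => ?_, fun x hx => ?_⟩
  · refine contDiff_id.add ((euclEncoder φ N).contDiff.comp (T₂.contDiff.comp (hG.comp
      (T₁.contDiff.comp (euclDecoder φ N).toContinuousLinearMap.contDiff))))
  · have hι : ∀ z ∈ Metric.closedBall (0 : EuclideanSpace ℝ (Fin N)) R,
        euclDecoder φ N z ∈ Metric.closedBall (0 : X) R := fun z hz => by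
      rwa [mem_closedBall_zero_iff, LinearIsometry.norm_map, ← mem_closedBall_zero_iff]
    set Z := euclDecoder φ N z with hZ
    set V := euclDecoder φ N w with hV
    set u := G (T₁ Z) - G (T₁ V) with hu
    have h1 : ‖Z - V‖ = ‖z - w‖ := by rw [hZ, hV, ← map_sub, LinearIsometry.norm_map]
    have h2 : ‖u‖ ≤ |M| * ‖T₁‖ * ‖z - w‖ := by
      calc ‖u‖ ≤ |M| * ‖T₁ Z - T₁ V‖ := hlip _ (hι z hz) _ (hι w hw)
        _ ≤ |M| * (‖T₁‖ * ‖Z - V‖) := by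
            rw [← map_sub]
            exact mul_le_mul_of_nonneg_left (T₁.le_opNorm _) (abs_nonneg _)
        _ = |M| * ‖T₁‖ * ‖z - w‖ := by rw [h1]; ring
    have h3 : ‖T₂ u - basisProj φ N (T₂ u)‖ ≤ c / 2 * ‖z - w‖ := by
      calc _ ≤ ε₁ * ‖u‖ := hN1 u
        _ ≤ c / (2 * (|M| * ‖T₁‖ + 1)) * ((|M| * ‖T₁‖ + 1) * ‖z - w‖) := by
            refine mul_le_mul (min_le_left _ _) (h2.trans ?_) (norm_nonneg _) (by positivity)
            exact mul_le_mul_of_nonneg_right (by linarith) (norm_nonneg _)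
        _ = c / 2 * ‖z - w‖ := by field_simp
    have h4 : F Z - F V = euclDecoder φ N ((z + euclEncoder φ N (T₂ (G (T₁ Z)))) -
        (w + euclEncoder φ N (T₂ (G (T₁ V))))) + (T₂ u - basisProj φ N (T₂ u)) := by
      rw [hFG, hFG, hu, map_sub, map_sub, map_add, map_add, ← basisProj_apply, ← basisProj_apply,
        map_sub, ← hZ, ← hV]
      abel
    have h5 := (hbi Z V).1
    rw [h4, h1] at h5
    have h6 := h5.trans (norm_add_le _ _)
    rw [LinearIsometry.norm_map] at h6
    linarith
  · have hx' := mem_closedBall_zero_iff.1 hx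
    have hPx : basisProj φ N x ∈ Metric.closedBall (0 : X) R := by
      rw [mem_closedBall_zero_iff]
      exact (norm_basisProj_le φ N x).trans hx'
    set v := G (T₁ (basisProj φ N x)) with hv
    have h1 : F x - (x - basisProj φ N x + euclDecoder φ N (euclEncoder φ N x +
        euclEncoder φ N (T₂ (G (T₁ (euclDecoder φ N (euclEncoder φ N x))))))) =
        T₂ (G (T₁ x) - v) + (T₂ v - basisProj φ N (T₂ v)) := by
      rw [hFG, map_add, ← basisProj_apply, ← basisProj_apply, map_sub, ← hv]
      abel
    have h2 : ‖T₂ (G (T₁ x) - v)‖ ≤ κ / 2 := by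
      calc _ ≤ ‖T₂‖ * ‖G (T₁ x) - v‖ := T₂.le_opNorm _
        _ ≤ ‖T₂‖ * (|M| * ε₂) := by
            refine mul_le_mul_of_nonneg_left ((hlip x hx _ hPx).trans ?_) (norm_nonneg _)
            rw [← map_sub]
            exact mul_le_mul_of_nonneg_left (hN2 x hx) (abs_nonneg _)
        _ ≤ (‖T₂‖ * |M| + 1) * ε₂ := by nlinarith
        _ = κ / 2 := by rw [hε₂]; field_simp
    have h3 : ‖T₂ v - basisProj φ N (T₂ v)‖ ≤ κ / 2 := by
      calc _ ≤ ε₁ * ‖v‖ := hN1 v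
        _ ≤ κ / (2 * (|M'| + 1)) * (|M'| + 1) :=
            mul_le_mul (min_le_right _ _) ((hbd _ hPx).trans (by linarith)) (norm_nonneg _)
              (by positivity)
        _ = κ / 2 := by field_simp
    rw [h1]
    exact (norm_add_le _ _).trans (by linarith)

end Reduction

/-! ### Lifting residual networks to the Hilbert space -/

section Lift

variable {X : Type*} [NormedAddCommGroup X] [InnerProductSpace ℝ X]
  (φ : HilbertBasis ℕ ℝ X) {N : ℕ}

theorem contDiff_lift {f : (Fin N → ℝ) → (Fin N → ℝ)} (hf : ContDiff ℝ 1 f) :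
    ContDiff ℝ 1 fun x : X => decoder φ N (f (encoder φ N x)) := by
  have h1 : ContDiff ℝ 1 fun x : X => encoder φ N x :=
    contDiff_pi.2 fun n => contDiff_id.inner ℝ contDiff_const
  have h2 : ContDiff ℝ 1 fun α : Fin N → ℝ => decoder φ N α :=
    ContDiff.sum fun n _ => (contDiff_apply ℝ ℝ n).smul contDiff_const
  exact h2.comp (hf.comp h1)

variable [CompleteSpace X]

theorem exists_coordinate_reflection (i₀ : Fin N) :
    ∃ A : X ≃ₗᵢ[ℝ] X, (∀ x, A x = x - (2 * ⟪x, φ i₀⟫_ℝ) • φ i₀) ∧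
      (∀ x, euclEncoder φ N (A x) = euclOp (coordReflection i₀) (euclEncoder φ N x)) ∧
      ∀ x, A x - basisProj φ N (A x) = x - basisProj φ N x := by
  have hA : ∀ x, (ℝ ∙ (φ i₀ : X))ᗮ.reflection x = x - (2 * ⟪x, φ i₀⟫_ℝ) • φ i₀ := by
    intro x
    rw [Submodule.reflection_orthogonal_apply, Submodule.reflection_singleton_apply,
      φ.orthonormal.1, real_inner_comm]
    simp only [RCLike.ofReal_one, one_pow, div_one]
    module
  refine ⟨(ℝ ∙ (φ i₀ : X))ᗮ.reflection, hA, fun x => ?_, fun x => ?_⟩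
  · ext n
    rw [hA, ofLp_euclEncoder, coordReflection, euclOp_diagonal_apply, ofLp_euclEncoder, encoder,
      encoder, inner_sub_left, real_inner_smul_left, orthonormal_iff_ite.1 φ.orthonormal]
    by_cases hn : n = i₀
    · subst hn
      simp
      ring
    · have hn' : (i₀ : ℕ) ≠ n := fun h => hn (Fin.ext h.symm)
      simp [hn, hn']
  · have h1 : basisProj φ N (φ i₀) = φ i₀ := by
      rw [basisProj_apply, euclDecoder_apply, ofLp_euclEncoder, decoder,
        Finset.sum_eq_single i₀ (fun n _ hn => ?_) (by simp)]
      · rw [encoder, orthonormal_iff_ite.1 φ.orthonormal]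
        simp
      · have hn' : (i₀ : ℕ) ≠ n := fun h => hn (Fin.ext h.symm)
        rw [encoder, orthonormal_iff_ite.1 φ.orthonormal]
        simp [hn']
    rw [hA, map_sub, map_smul, h1]
    abel

theorem decoder_net_encoder (f : (Fin N → ℝ) → (Fin N → ℝ)) (x : X) :
    decoder φ N (f (encoder φ N x)) = euclDecoder φ N (euclMap f (euclEncoder φ N x)) := by
  rw [euclDecoder_apply, euclMap, ofLp_euclEncoder]

/-- The lifted blocks act on the coordinates and leave the orthogonal complement fixed. -/
theorem residualComp_lift (f : ℕ → (Fin N → ℝ) → (Fin N → ℝ)) (T : ℕ) (x : X) :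
    residualComp (fun t x => decoder φ N (f t (encoder φ N x))) T x = x - basisProj φ N x +
      euclDecoder φ N (residualComp (fun t => euclMap (f t)) T (euclEncoder φ N x)) := by
  induction T with
  | zero => simp [residualComp, basisProj_apply]
  | succ T ih =>
    rw [residualComp, residualComp]
    beta_reduce
    rw [decoder_net_encoder, ih]
    have h1 : ∀ z, euclEncoder φ N (x - basisProj φ N x + euclDecoder φ N z) = z := fun z => by
      rw [map_add, map_sub, basisProj_apply, euclEncoder_euclDecoder, sub_self, zero_add,
        euclEncoder_euclDecoder]
    rw [h1, map_add]
    abel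

variable {σ : ℝ → ℝ} {δ : ℝ} {f : (Fin N → ℝ) → (Fin N → ℝ)}

theorem IsSmallNet.lipschitz_lift (hf : IsSmallNet σ δ f) (x y : X) :
    ‖decoder φ N (f (encoder φ N x)) - decoder φ N (f (encoder φ N y))‖ ≤ 1 / 4 * ‖x - y‖ := by
  rw [decoder_net_encoder, decoder_net_encoder, ← map_sub, LinearIsometry.norm_map]
  refine (hf.lipschitz _ _).trans ?_
  rw [← map_sub]
  exact mul_le_mul_of_nonneg_left (norm_euclEncoder_le φ N _) (by norm_num)

theorem IsSmallNet.bounded_lift (hf : IsSmallNet σ δ f) (x : X) :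
    ‖decoder φ N (f (encoder φ N x))‖ ≤ δ := by
  rw [decoder_net_encoder, LinearIsometry.norm_map]
  exact hf.bounded _

theorem basisProj_lift (x : X) : basisProj φ N (decoder φ N (f (encoder φ N x))) =
    decoder φ N (f (encoder φ N x)) := by
  rw [decoder_net_encoder, basisProj_apply, euclEncoder_euclDecoder]

theorem lift_basisProj (x : X) : decoder φ N (f (encoder φ N (basisProj φ N x))) =
    decoder φ N (f (encoder φ N x)) := by
  rw [decoder_net_encoder, decoder_net_encoder, basisProj_apply, euclEncoder_euclDecoder]

/-- A bilipschitz layer is approximated on a ball by small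
residual networks, precomposed with the identity or a reflection. -/
theorem IsBilipschitzLayer.exists_residual_approx {F : X → X} (hF : IsBilipschitzLayer F)
    (hσ : IsAdmissibleActivation σ) {R : ℝ} (hR : 0 < R) (hδ : 0 < δ) {ε : ℝ} (hε : 0 < ε)
    (N₀ : ℕ) :
    ∃ (T N : ℕ) (f : ℕ → (Fin N → ℝ) → (Fin N → ℝ)) (A : X ≃ₗᵢ[ℝ] X), 1 ≤ T ∧ N₀ < N ∧
      (∀ t, IsSmallNet σ δ (f t)) ∧
      ((∀ x, A x = x) ∨ ∃ e : X, ‖e‖ = 1 ∧ ∀ x, A x = x - (2 * ⟪x, e⟫_ℝ) • e) ∧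
      ∀ x ∈ Metric.closedBall (0 : X) R,
        ‖F x - residualComp (fun t x => decoder φ N (f t (encoder φ N x))) T (A x)‖ ≤ ε := by
  obtain ⟨N, hN, g, c, hg, hc, hlow, happ⟩ :=
    hF.exists_finite_dimensional φ hR (half_pos hε) (N₀ + 1)
  let i₀ : Fin N := ⟨0, by omega⟩
  have key : ∀ (a : EuclideanSpace ℝ (Fin N) → EuclideanSpace ℝ (Fin N)) (A : X ≃ₗᵢ[ℝ] X),
      Reachable (Metric.closedBall 0 R) a g → (∀ z, ‖a z‖ = ‖z‖) →
      (∀ x, euclEncoder φ N (A x) = a (euclEncoder φ N x)) →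
      (∀ x, A x - basisProj φ N (A x) = x - basisProj φ N x) →
      ∃ (T : ℕ) (f : ℕ → (Fin N → ℝ) → (Fin N → ℝ)), 1 ≤ T ∧ (∀ t, IsSmallNet σ δ (f t)) ∧
        ∀ x ∈ Metric.closedBall (0 : X) R,
          ‖F x - residualComp (fun t x => decoder φ N (f t (encoder φ N x))) T (A x)‖ ≤ ε := by
    intro a A hreach ha hA1 hA2
    obtain ⟨T, f, hT, hf, hTf⟩ := hreach.exists_isSmallNet hσ hδ
      (D := R) (fun z hz => (ha z).trans_le (mem_closedBall_zero_iff.1 hz)) (half_pos hε)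
    refine ⟨T, f, hT, hf, fun x hx => ?_⟩
    have h1 := happ x hx
    have h2 := hTf (euclEncoder φ N x) (mem_closedBall_zero_iff.2
      ((norm_euclEncoder_le φ N x).trans (mem_closedBall_zero_iff.1 hx)))
    rw [residualComp_lift, hA1, hA2]
    rw [← (euclDecoder φ N).norm_map, map_sub, norm_sub_rev] at h2
    refine le_trans ?_ ((norm_add_le_of_le h1 h2).trans_eq (add_halves ε))
    apply le_of_eq
    congr 1
    abel
  rcases exists_reachable_of_contDiff i₀ hg hR hc hlow with h | h
  · obtain ⟨T, f, hT, hf, hTf⟩ := key id (LinearIsometryEquiv.refl ℝ X) h (fun _ => rfl)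
      (fun _ => rfl) (fun _ => rfl)
    exact ⟨T, N, f, _, hT, by omega, hf, .inl fun _ => rfl, hTf⟩
  · obtain ⟨A, hA, hA1, hA2⟩ := exists_coordinate_reflection φ i₀
    obtain ⟨T, f, hT, hf, hTf⟩ := key _ A h (norm_euclOp_coordReflection i₀) hA1 hA2
    exact ⟨T, N, f, A, hT, by omega, hf, .inr ⟨φ i₀, φ.orthonormal.1 _, hA⟩, hTf⟩

end Lift

end

theorem mainTheorem6 {d : ℕ} (D : Set (EuclideanSpace ℝ (Fin d)))
    (hD_open : IsOpen D) (hD_conn : IsConnected D) (hD_bdd : Bornology.IsBounded D)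
    (φ : HilbertBasis ℕ ℝ (L2Space D))
    (hφ : ∃ (n : ℕ) (c : ℝ), φ n =ᵐ[volume.restrict D] fun _ => c)
    (σ : ℝ → ℝ) (hσ : σ = recuAct ∨ σ = reluAct)
    (R : ℝ) (hR : 0 < R)
    (F : L2Space D → L2Space D) (hF : IsBilipschitzLayer F)
    (δ : ℝ) (hδ : δ ∈ Set.Ioo (0 : ℝ) 1) (ε : ℝ) (hε : ε ∈ Set.Ioo (0 : ℝ) 1) :
    ∃ (T N : ℕ) (G : L2Space D → L2Space D)
      (NN : ℕ → (Fin N → ℝ) → (Fin N → ℝ)) (B : ℕ → L2Space D → L2Space D)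
      (A : L2Space D ≃L[ℝ] L2Space D) (R' : ℝ) (Γ K : ℕ → Set (L2Space D))
      (L : ℕ → L2Space D → L2Space D) (Φ : L2Space D → L2Space D),
      1 ≤ T ∧ 1 ≤ N ∧
      -- `G` is a residual neural operator with blocks `Id + D_N ∘ NN_t ∘ E_N`
      G ∈ ResidualNeuralOperatorClass T N φ σ ∧
      (∀ t, 1 ≤ t → t ≤ T → IsFeedforwardNet σ (NN t)) ∧
      (∀ t, B t = fun x => decoder φ N (NN t (encoder φ N x))) ∧
      (∀ t, 1 ≤ t → t ≤ T → ∃ l, 1 ≤ l ∧ B t ∈ NeuralOperatorClass l N φ σ) ∧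
      G = residualComp B T ∧
      -- `A` is the identity or a reflection
      ((∀ x, A x = x) ∨
        ∃ e : L2Space D, ‖e‖ = 1 ∧ ∀ x, A x = x - (2 * ⟪x, e⟫_ℝ) • e) ∧
      -- approximation on the closed ball
      (∀ x ∈ Metric.closedBall (0 : L2Space D) R, ‖F x - G (A x)‖ ≤ ε) ∧
      -- the balls `Γ_t` and the successive images `K_t` of `A(B(0, R))`
      0 < R' ∧
      (∀ t, Γ t = Metric.ball 0 (R' + t * δ)) ∧
      (∀ t, K t = (fun x => residualComp B t (A x)) '' Metric.ball 0 R) ∧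
      (∀ t ≤ T, K t ⊆ Γ t) ∧
      -- each block is strongly monotone, and for ReCU a `C¹`-diffeomorphism, on `Γ_t`
      (∀ t, 1 ≤ t → t ≤ T → StronglyMonotoneOn (fun x => x + B t x) (Γ t)) ∧
      (σ = recuAct → ∀ t, 1 ≤ t → t ≤ T → IsC1DiffeoOn (fun x => x + B t x) (Γ t)) ∧
      -- the block inverses `L_t : Γ_t → Γ_{t+1}` as limits of the fixed-point iteration
      (∀ t, 1 ≤ t → t ≤ T →
        Set.MapsTo (inversionStep (B t)) (Γ (t + 1) ×ˢ Γ t) (Γ (t + 1) ×ˢ Γ t) ∧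
        (∀ y ∈ Γ t, Tendsto (fun n : ℕ => ((inversionStep (B t))^[n] (0, y)).1) atTop
          (𝓝 (L t y))) ∧
        Set.MapsTo (L t) (Γ t) (Γ (t + 1)) ∧
        Set.MapsTo (L t) (K t) (K (t - 1))) ∧
      -- `Φ = L_1 ∘ ⋯ ∘ L_T` on `G(A(B(0, R)))`, and `A⁻¹ ∘ Φ` inverts `G ∘ A` on `B(0, R)`
      IsGeneralizedNeuralOperator Φ ∧
      Set.EqOn Φ (reverseComp L T) ((G ∘ A) '' Metric.ball 0 R) ∧
      Set.MapsTo Φ ((G ∘ A) '' Metric.ball 0 R) (A '' Metric.ball 0 R) ∧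
      Set.BijOn (G ∘ A) (Metric.ball 0 R) ((G ∘ A) '' Metric.ball 0 R) ∧
      Set.InvOn (A.symm ∘ Φ) (G ∘ A) (Metric.ball 0 R) ((G ∘ A) '' Metric.ball 0 R) := by
  obtain ⟨n₀, c, hc⟩ := hφ
  have hadm := isAdmissibleActivation_of_eq hσ
  have hσ1 : σ 1 = 1 := by rcases hσ with rfl | rfl <;> norm_num [recuAct, reluAct]
  obtain ⟨T, N, f, A, hT, hN, hf, hA, happ⟩ :=
    hF.exists_residual_approx φ hadm hR hδ.1 hε.1 n₀
  set B : ℕ → L2Space D → L2Space D := fun t x => decoder φ N (f t (encoder φ N x)) with hB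
  have hBlip : ∀ t x y, ‖B t x - B t y‖ ≤ 1 / 4 * ‖x - y‖ := fun t => (hf t).lipschitz_lift φ
  have hBbd : ∀ t x, ‖B t x‖ ≤ δ := fun t => (hf t).bounded_lift φ
  have hBC1 : σ = recuAct → ∀ t, ContDiff ℝ 1 (B t) := fun h t =>
    contDiff_lift φ ((hf t).contDiff h)
  have hBop : ∀ t, ∃ l, 1 ≤ l ∧ B t ∈ NeuralOperatorClass l N φ σ := fun t =>
    mem_neuralOperatorClass hσ1 hc hN hadm.representsId (hf t).isNet
  choose L hL using fun t => exists_isPerturbationInverse (hBlip t)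
  have hAnorm : ∀ x, ‖x‖ < R → ‖A x‖ < R := fun x hx => by rwa [A.norm_map]
  have hinv : ∀ x, reverseComp L T (residualComp B T (A x)) = A x := fun x =>
    reverseComp_residualComp hL T (A x)
  refine ⟨T, N, residualComp B T, f, B, A.toContinuousLinearEquiv, R,
    fun t => Metric.ball 0 (R + t * δ),
    fun t => (fun x => residualComp B t (A x)) '' Metric.ball 0 R, L, reverseComp L T, hT,
    by omega, ⟨B, fun t _ _ => hBop t, rfl⟩, fun t _ _ => (hf t).isNet, fun _ => rfl,
    fun t _ _ => hBop t, rfl, hA, happ, hR, fun _ => rfl, fun _ => rfl, ?_,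
    fun t _ _ => stronglyMonotoneOn_of_contraction (hBlip t) _,
    fun h t _ _ => isC1DiffeoOn_perturbation (hBlip t) (hBC1 h t) Metric.isOpen_ball, ?_, ?_,
    fun _ _ => rfl, ?_, ?_, ?_⟩
  · rintro t - _ ⟨x, hx, rfl⟩
    exact mem_ball_zero_iff.2
      (norm_residualComp_lt hBbd (hAnorm x (mem_ball_zero_iff.1 hx)) t)
  · intro t ht _
    refine ⟨?_, fun y _ => (hL t).tendsto y, fun y hy => ?_, ?_⟩
    · rintro ⟨x, y⟩ ⟨-, hy⟩
      refine ⟨mem_ball_zero_iff.2 ?_, hy⟩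
      have hy' := mem_ball_zero_iff.1 hy
      refine (norm_sub_le y (B t x)).trans_lt ?_
      push_cast
      linarith [hBbd t x]
    · have hy' := mem_ball_zero_iff.1 hy
      refine mem_ball_zero_iff.2 ?_
      have h1 : L t y = y - B t (L t y) := eq_sub_of_add_eq ((hL t).right y)
      rw [h1]
      refine (norm_sub_le _ _).trans_lt ?_
      push_cast
      linarith [hBbd t (L t y)]
    · obtain ⟨s, rfl⟩ : ∃ s, t = s + 1 := ⟨t - 1, by omega⟩
      rintro _ ⟨x, hx, rfl⟩
      exact ⟨x, hx, ((hL (s + 1)).left _).symm⟩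
  · rcases hσ with h | -
    -- For the rectified cubic unit each inverse `L t` is itself a layer. For the rectified linear
    -- unit it is piecewise affine, in general not differentiable, so that it can enter only through
    -- the continuous operation `S`.
    · refine isGeneralizedNeuralOperator_reverseComp hT fun t => ?_
      exact isNeuralOperatorLayer_perturbationInverse (hL t) (hBC1 h t)
        (contDiff_perturbationInverse (hBlip t) (hBC1 h t) (hL t))
        (isCompactOperator_basisProj φ N) (basisProj_lift φ) (lift_basisProj φ)
    · exact isGeneralizedNeuralOperator_of_continuous (continuous_reverseComp hL T)
  · rintro _ ⟨x, hx, rfl⟩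
    exact ⟨x, hx, (hinv x).symm⟩
  · refine ⟨Set.mapsTo_image _ _, fun x _ y _ hxy => ?_, Set.surjOn_image _ _⟩
    exact A.injective (by rw [← hinv x, ← hinv y]; exact congrArg _ hxy)
  · refine ⟨fun x _ => ?_, ?_⟩
    · exact (congrArg A.symm (hinv x)).trans (A.symm_apply_apply x)
    · rintro _ ⟨x, -, rfl⟩
      refine congrArg (residualComp B T) ?_
      exact (A.apply_symm_apply _).trans (hinv x)
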